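/- A polytope in $\mathbb{R}^n$ is the convex hull of a finite set of points, and its $k$-skeleton is the union of its $k$-dimensional faces (the polytope counts as a face of itself). For $S\subset\mathbb{R}^n$, a scaled copy of $S$ centered at $x\in\mathbb{R}^n$ is a set $x+rS=\{x+rs : s\in S\}$ with $r>0$. Write $\dim$ for Hausdorff dimension. Let $0\le k<n$ be integers, let $S$ be the $k$-skeleton of an arbitrary polytope $P$ in $\mathbb{R}^n$ of dimension at least $k$ (that is, with $S\neq\emptyset$), and let $d\in[0,n]$ be real. (i) Suppose that $0$ is not contained in the affine span of any $k$-dimensional face of $P$. Then the smallest possible value of $\dim A$, over all compact sets $A\subset\mathbb{R}^n$ that contain a scaled copy of $S$ centered at each point of some nonempty compact set $C\subset\mathbb{R}^n$ with $\dim C=d$, is $\max(d-1,k)$; in particular this minimum is attained. (ii) Suppose that $0$ is contained in the affine span of at least one $k$-dimensional face of $P$. Then the smallest possible value of $\dim A$, over all compact sets $A\subset\mathbb{R}^n$ that contain a scaled copy of $S$ centered at each point of some nonempty compact set $C\subset\mathbb{R}^n$ with $\dim C=d$, is $\max(d,k)$; in particular this minimum is attained. -/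

import Mathlib

/-- A (convex) polytope: the convex hull of a finite set of points of `ℝⁿ`. -/
def IsPolytope {n : ℕ} (P : Set (EuclideanSpace ℝ (Fin n))) : Prop :=
  ∃ s : Finset (EuclideanSpace ℝ (Fin n)), P = convexHull ℝ (s : Set (EuclideanSpace ℝ (Fin n)))

/-- `F` is a `k`-dimensional face of `P`: a nonempty set of maximizers over `P` of some linear
functional (the zero functional gives `P` itself) whose affine span has dimension `k`. -/
def IsKFace {n : ℕ} (k : ℕ) (P F : Set (EuclideanSpace ℝ (Fin n))) : Prop :=
  F.Nonempty ∧ IsExposed ℝ P F ∧ Module.finrank ℝ (vectorSpan ℝ F) = k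

/-- The `k`-skeleton of `P`: the union of its `k`-dimensional faces. -/
def kSkeleton {n : ℕ} (k : ℕ) (P : Set (EuclideanSpace ℝ (Fin n))) :
    Set (EuclideanSpace ℝ (Fin n)) :=
  {x | ∃ F, IsKFace k P F ∧ x ∈ F}

/-- The scaled copy `x + r S` of `S`, centered at `x`. -/
def scaledCopy {n : ℕ} (x : EuclideanSpace ℝ (Fin n)) (r : ℝ)
    (S : Set (EuclideanSpace ℝ (Fin n))) : Set (EuclideanSpace ℝ (Fin n)) :=
  (fun s => x + r • s) '' S

/-- `A` contains a scaled copy of `S` centered at each point of `C`. -/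
def ContainsScaledCopies {n : ℕ} (S C A : Set (EuclideanSpace ℝ (Fin n))) : Prop :=
  ∀ x ∈ C, ∃ r : ℝ, 0 < r ∧ scaledCopy x r S ⊆ A

/-- The Hausdorff dimensions of the compact sets `A` that contain a scaled copy of `S` centered at
each point of some nonempty compact set `C` of Hausdorff dimension `d`. -/
def possibleDims {n : ℕ} (S : Set (EuclideanSpace ℝ (Fin n))) (d : ℝ) : Set ENNReal :=
  {a | ∃ A C : Set (EuclideanSpace ℝ (Fin n)), IsCompact A ∧ IsCompact C ∧ C.Nonempty ∧
    dimH C = ENNReal.ofReal d ∧ ContainsScaledCopies S C A ∧ dimH A = a}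

/-! Write V for the direction of a k-face F, and split each point into its components in V and in
Vᗮ. The Vᗮ-component is constant on F, so the copy x + rF lies in a single translate of V. The
position of that translate is L_F(x, r) = proj x + r • proj y, where proj is the projection to Vᗮ
and y is any point of F.

Lower bound (`IsKFace.dimH_le`). Let D ⊆ Vᗮ be the set of positions over which A contains a ball of
V. A Fubini-type slicing estimate (`dimH_add_finrank_le_of_ball_subset`) gives dim A ≥ dim D + k.
Every center lies in D + W as soon as W contains V and F, so dim C ≤ dim D + dim W. If 0 is in the
affine span of F, then W = V works and the loss is k. Otherwise W = V ⊕ ℝ proj y has dimension k +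
1, which costs one more dimension.

Upper bound (`IsPolytope.exists_mem_possibleDims_le`). The union of the copies over a compact set K
of pairs (x, r) is covered by the finitely many sets L_F(K) + V. It is therefore enough that the
centers have dimension d while dim L_F(K) ≤ max(d - p, 0) for every F at once, with p = k + 1 in
case (i) and p = k in case (ii). Such a K is built in `exists_isCompact_dimH_fst_eq` from digit
expansions with super-exponentially decreasing scales. Each stage uses an orthonormal basis adapted
to one face: its first p vectors span W, and with suitable changes of radius they are killed by L_F.
Each face is served infinitely often. Hausdorff dimension can be bounded above along a sparse
sequence of scales, and earlier stages are negligible at the next scale, so L_F(K) loses the weight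
of p directions. The centers lose nothing, because at every stage their expansion uses a full
orthonormal basis. -/

open MeasureTheory Set Filter Topology
open scoped ENNReal NNReal Pointwise

/-! ### Null sets of Hausdorff measure in terms of covers -/

section HausdorffCovers

variable {X : Type*} [EMetricSpace X] [MeasurableSpace X] [BorelSpace X]

/-- A set of zero `t`-dimensional Hausdorff measure has covers by small sets of arbitrarily small
total size, where the sizes may be taken strictly positive. -/
lemma exists_cover_of_hausdorffMeasure_eq_zero {t : ℝ} (ht : 0 < t) {s : Set X}
    (hs : μH[t] s = 0) {ε : ℝ} (hε : 0 < ε) :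
    ∃ (U : ℕ → Set X) (r : ℕ → ℝ), s ⊆ ⋃ j, U j ∧ (∀ j, 0 < r j ∧ r j ≤ ε) ∧
      (∀ j, Metric.ediam (U j) ≤ ENNReal.ofReal (r j)) ∧
      ∑' j, ENNReal.ofReal (r j ^ t) ≤ ENNReal.ofReal ε := by
  rw [Measure.hausdorffMeasure_apply] at hs
  simp only [ENNReal.iSup_eq_zero] at hs
  have h1 := hs (ENNReal.ofReal (ε / 2)) (by simpa using hε)
  have h2 : (⨅ (U : ℕ → Set X) (_ : s ⊆ ⋃ n, U n)
      (_ : ∀ n, Metric.ediam (U n) ≤ ENNReal.ofReal (ε / 2)),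
      ∑' n, ⨆ _ : (U n).Nonempty, Metric.ediam (U n) ^ t) < ENNReal.ofReal (ε / 2) := by
    rw [h1]; simpa using hε
  simp only [iInf_lt_iff] at h2
  obtain ⟨U, hU, hd, hsum⟩ := h2
  -- A diameter may be 0, so each size is taken slightly larger than it. The excesses in the sum are
  -- geometric with total ε/2.
  have key : ∀ j, ∃ r : ℝ, 0 < r ∧ r ≤ ε ∧ Metric.ediam (U j) ≤ ENNReal.ofReal r ∧
      ENNReal.ofReal (r ^ t) ≤ Metric.ediam (U j) ^ t + ENNReal.ofReal (ε / 2 / 2 / 2 ^ j) := by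
    intro j
    set D := (Metric.ediam (U j)).toReal with hD
    have hfin : Metric.ediam (U j) ≠ ∞ := ne_top_of_le_ne_top ENNReal.ofReal_ne_top (hd j)
    have hDe : Metric.ediam (U j) = ENNReal.ofReal D := (ENNReal.ofReal_toReal hfin).symm
    have hD0 : 0 ≤ D := ENNReal.toReal_nonneg
    have hDε : D ≤ ε / 2 := by
      have := hd j
      rw [hDe] at this
      exact (ENNReal.ofReal_le_ofReal_iff (by positivity)).1 this
    have hcont : ContinuousAt (fun x : ℝ => x ^ t) D :=
      Real.continuousAt_rpow_const _ _ (Or.inr ht.le)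
    have hev : ∀ᶠ x in 𝓝[>] D, x ^ t < D ^ t + ε / 2 / 2 / 2 ^ j :=
      (hcont.tendsto.mono_left nhdsWithin_le_nhds).eventually
        (gt_mem_nhds (lt_add_of_pos_right _ (by positivity)))
    have hev2 : ∀ᶠ x in 𝓝[>] D, x < ε :=
      nhdsWithin_le_nhds (gt_mem_nhds (by linarith))
    obtain ⟨x, ⟨hx1, hx2⟩, hx3⟩ := ((hev.and hev2).and self_mem_nhdsWithin).exists
    have hx3' : D < x := hx3
    refine ⟨x, hD0.trans_lt hx3', hx2.le, ?_, ?_⟩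
    · rw [hDe]; exact ENNReal.ofReal_le_ofReal hx3'.le
    · rw [hDe, ENNReal.ofReal_rpow_of_nonneg hD0 ht.le, ← ENNReal.ofReal_add (by positivity)
        (by positivity)]
      exact ENNReal.ofReal_le_ofReal hx1.le
  choose r hr0 hr1 hr2 hr3 using key
  refine ⟨U, r, hU, fun j => ⟨hr0 j, hr1 j⟩, hr2, ?_⟩
  have hgeo : ∑' j : ℕ, ENNReal.ofReal (ε / 2 / 2 / 2 ^ j) = ENNReal.ofReal (ε / 2) := by
    rw [← ENNReal.ofReal_tsum_of_nonneg (fun j => by positivity) (summable_geometric_two' _),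
      tsum_geometric_two']
  have hterm : ∀ n, Metric.ediam (U n) ^ t ≤ ⨆ _ : (U n).Nonempty, Metric.ediam (U n) ^ t := by
    intro n
    rcases (U n).eq_empty_or_nonempty with h | h
    · simp [h, ENNReal.zero_rpow_of_pos ht]
    · simp [h]
  calc ∑' j, ENNReal.ofReal (r j ^ t)
      ≤ ∑' j, (Metric.ediam (U j) ^ t + ENNReal.ofReal (ε / 2 / 2 / 2 ^ j)) :=
        ENNReal.tsum_le_tsum hr3
    _ = ∑' j, Metric.ediam (U j) ^ t + ENNReal.ofReal (ε / 2) := by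
        rw [ENNReal.tsum_add, hgeo]
    _ ≤ ENNReal.ofReal (ε / 2) + ENNReal.ofReal (ε / 2) := by
        gcongr
        exact (ENNReal.tsum_le_tsum hterm).trans hsum.le
    _ = ENNReal.ofReal ε := by
        rw [← ENNReal.ofReal_add (by positivity) (by positivity)]; congr 1; ring

/-- Covers by small sets of arbitrarily small total size show that the Hausdorff measure is zero. -/
lemma hausdorffMeasure_eq_zero_of_cover {t : ℝ} (ht : 0 ≤ t) {s : Set X}
    (h : ∀ ε : ℝ, 0 < ε → ∃ (ι : Type) (_ : Countable ι) (U : ι → Set X) (r : ι → ℝ),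
      s ⊆ ⋃ j, U j ∧ (∀ j, 0 ≤ r j ∧ r j ≤ ε) ∧
      (∀ j, Metric.ediam (U j) ≤ ENNReal.ofReal (r j)) ∧
      ∑' j, ENNReal.ofReal (r j ^ t) ≤ ENNReal.ofReal ε) :
    μH[t] s = 0 := by
  have hpos : ∀ m : ℕ, (0 : ℝ) < 1 / ((m : ℝ) + 1) := fun m => by positivity
  choose ι hι U r hU hr hd hsum using fun m : ℕ => h _ (hpos m)
  have hlim : Tendsto (fun m : ℕ => ENNReal.ofReal (1 / ((m : ℝ) + 1))) atTop (𝓝 0) := by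
    have := ENNReal.tendsto_ofReal (tendsto_one_div_add_atTop_nhds_zero_nat (𝕜 := ℝ))
    simpa using this
  have h1 := Measure.hausdorffMeasure_le_liminf_tsum t s _ hlim U
    (Eventually.of_forall fun m i => (hd m i).trans (ENNReal.ofReal_le_ofReal (hr m i).2))
    (Eventually.of_forall hU)
  refine le_antisymm (h1.trans ?_) bot_le
  have h2 : liminf (fun m => ∑' i, Metric.ediam (U m i) ^ t) atTop ≤
      liminf (fun m : ℕ => ENNReal.ofReal (1 / ((m : ℝ) + 1))) atTop := by
    refine liminf_le_liminf (Eventually.of_forall fun m => ?_)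
    refine le_trans (ENNReal.tsum_le_tsum fun i => ?_) (hsum m)
    rw [← ENNReal.ofReal_rpow_of_nonneg (hr m i).1 ht]
    exact ENNReal.rpow_le_rpow (hd m i) ht
  rwa [hlim.liminf_eq] at h2

end HausdorffCovers

/-- To bound a Hausdorff dimension by a real number, it suffices to show that the Hausdorff measures
of larger exponents vanish. -/
lemma dimH_le_of_forall_hausdorffMeasure_eq_zero {X : Type*} [EMetricSpace X] [MeasurableSpace X]
    [BorelSpace X] {s : Set X} {a : ℝ≥0∞}
    (h : ∀ t : ℝ≥0, a < t → μH[(t : ℝ)] s = 0) : dimH s ≤ a := by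
  by_contra! hlt
  obtain ⟨t, h1, h2⟩ := ENNReal.lt_iff_exists_nnreal_btwn.1 hlt
  have := hausdorffMeasure_of_lt_dimH h2
  simp [h t h1] at this

/-! ### Upper bounds: adding a subspace -/

section AddSubspace

variable {E : Type*} [NormedAddCommGroup E] [NormedSpace ℝ E]

/-- Thickening a `t`-null set by a segment gives a `(t + 1)`-null set. -/
lemma hausdorffMeasure_add_segment_eq_zero [MeasurableSpace E] [BorelSpace E] {X : Set E} {t : ℝ}
    (ht : 0 < t) (hX : μH[t] X = 0) (e : E) :
    μH[t + 1] (image2 (fun x (a : ℝ) => x + a • e) X (Icc 0 1)) = 0 := by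
  refine hausdorffMeasure_eq_zero_of_cover (by positivity) fun ε hε => ?_
  set C : ℝ := 1 + ‖e‖ with hC
  have hC1 : 1 ≤ C := by simp [hC]
  have hC0 : 0 < C := by linarith
  have hCt : 0 < C ^ (t + 1) := by positivity
  obtain ⟨ε', hε'0, hε'1, hε'2, hε'3⟩ : ∃ ε' : ℝ, 0 < ε' ∧ ε' ≤ 1 ∧ C * ε' ≤ ε ∧
      2 * C ^ (t + 1) * ε' ≤ ε := by
    refine ⟨min 1 (min (ε / C) (ε / (2 * C ^ (t + 1)))), by positivity, min_le_left _ _, ?_, ?_⟩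
    · rw [← le_div_iff₀' hC0]
      exact (min_le_right _ _).trans (min_le_left _ _)
    · rw [← le_div_iff₀' (by positivity)]
      exact (min_le_right _ _).trans (min_le_right _ _)
  obtain ⟨U, r, hU, hr, hd, hsum⟩ := exists_cover_of_hausdorffMeasure_eq_zero ht hX hε'0
  -- Over a set of size r, the segment is cut into ⌈1/r⌉ ≤ 2/r pieces of length r. Each product
  -- piece has diameter at most C r, so the total is at most 2 C^(t+1) r^t.
  refine ⟨Σ j, Fin ⌈1 / r j⌉₊, inferInstance,
    fun q => image2 (fun x (a : ℝ) => x + a • e) (U q.1)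
      (Icc ((q.2 : ℝ) * r q.1) (((q.2 : ℝ) + 1) * r q.1)),
    fun q => C * r q.1, ?_, ?_, ?_, ?_⟩
  · rintro _ ⟨x, hx, a, ha, rfl⟩
    obtain ⟨j, hj⟩ := mem_iUnion.1 (hU hx)
    have hrj := (hr j).1
    have hmpos : 0 < ⌈1 / r j⌉₊ := Nat.ceil_pos.2 (by positivity)
    rcases lt_or_ge ⌊a / r j⌋₊ ⌈1 / r j⌉₊ with hlt | hge
    · refine mem_iUnion.2 ⟨⟨j, ⟨⌊a / r j⌋₊, hlt⟩⟩, mem_image2_of_mem hj ⟨?_, ?_⟩⟩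
      · rw [← le_div_iff₀ hrj]
        exact Nat.floor_le (div_nonneg ha.1 hrj.le)
      · rw [← div_le_iff₀ hrj]
        exact (Nat.lt_floor_add_one _).le
    -- This occurs only for a = 1 with 1/r an integer; the right endpoint belongs to the last closed
    -- piece.
    · refine mem_iUnion.2 ⟨⟨j, ⟨⌈1 / r j⌉₊ - 1, by omega⟩⟩, mem_image2_of_mem hj ?_⟩
      have h1 : (⌈1 / r j⌉₊ : ℝ) ≤ a / r j :=
        (Nat.cast_le.2 hge).trans (Nat.floor_le (div_nonneg ha.1 hrj.le))
      have h2 : 1 / r j ≤ (⌈1 / r j⌉₊ : ℝ) := Nat.le_ceil _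
      have h3 : ((⌈1 / r j⌉₊ - 1 : ℕ) : ℝ) = (⌈1 / r j⌉₊ : ℝ) - 1 := by
        rw [Nat.cast_sub hmpos]; simp
      rw [le_div_iff₀ hrj] at h1
      rw [div_le_iff₀ hrj] at h2
      refine ⟨?_, ?_⟩
      · simp only [h3]; nlinarith
      · simp only [h3]; nlinarith [ha.2]
  · intro q
    have := hr q.1
    exact ⟨mul_nonneg hC0.le this.1.le, (mul_le_mul_of_nonneg_left this.2 hC0.le).trans hε'2⟩
  · rintro ⟨j, m⟩
    refine Metric.ediam_le ?_
    rintro _ ⟨x, hx, a, ha, rfl⟩ _ ⟨y, hy, b, hb, rfl⟩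
    have hxy : dist x y ≤ r j := by
      have := (Metric.edist_le_ediam_of_mem hx hy).trans (hd j)
      rwa [edist_dist, ENNReal.ofReal_le_ofReal_iff (hr j).1.le] at this
    rw [edist_dist]
    refine ENNReal.ofReal_le_ofReal ?_
    have hab : |a - b| ≤ r j := by
      rw [abs_le]; constructor <;> nlinarith [ha.1, ha.2, hb.1, hb.2]
    calc dist (x + a • e) (y + b • e) ≤ dist x y + dist (a • e) (b • e) := dist_add_add_le _ _ _ _
      _ ≤ r j + r j * ‖e‖ := by
          gcongr
          rw [dist_eq_norm, ← sub_smul, norm_smul, Real.norm_eq_abs]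
          gcongr
      _ = C * r j := by rw [hC]; ring
  · rw [ENNReal.tsum_sigma' (fun q : (Σ j, Fin ⌈1 / r j⌉₊) => ENNReal.ofReal ((C * r q.1) ^ (t + 1)))]
    have hterm : ∀ j, ∑' _ : Fin ⌈1 / r j⌉₊, ENNReal.ofReal ((C * r j) ^ (t + 1)) ≤
        ENNReal.ofReal (2 * C ^ (t + 1)) * ENNReal.ofReal (r j ^ t) := by
      intro j
      have hrj := (hr j).1
      rw [tsum_fintype, Finset.sum_const, Finset.card_univ, Fintype.card_fin, nsmul_eq_mul,
        ← ENNReal.ofReal_natCast, ← ENNReal.ofReal_mul (by positivity),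
        ← ENNReal.ofReal_mul (by positivity)]
      refine ENNReal.ofReal_le_ofReal ?_
      rw [Real.mul_rpow hC0.le hrj.le, Real.rpow_add_one hrj.ne']
      have h1 : (⌈1 / r j⌉₊ : ℝ) * r j ≤ 2 := by
        have := (Nat.ceil_lt_add_one (by positivity : 0 ≤ 1 / r j)).le
        have h3 := (hr j).2.trans hε'1
        calc (⌈1 / r j⌉₊ : ℝ) * r j ≤ (1 / r j + 1) * r j := by gcongr
          _ = 1 + r j := by field_simp
          _ ≤ 2 := by linarith
      calc (⌈1 / r j⌉₊ : ℝ) * (C ^ (t + 1) * (r j ^ t * r j))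
          = ((⌈1 / r j⌉₊ : ℝ) * r j) * (C ^ (t + 1) * r j ^ t) := by ring
        _ ≤ 2 * (C ^ (t + 1) * r j ^ t) := by gcongr
        _ = _ := by ring
    calc ∑' j, ∑' _ : Fin ⌈1 / r j⌉₊, ENNReal.ofReal ((C * r j) ^ (t + 1))
        ≤ ∑' j, ENNReal.ofReal (2 * C ^ (t + 1)) * ENNReal.ofReal (r j ^ t) :=
          ENNReal.tsum_le_tsum hterm
      _ = ENNReal.ofReal (2 * C ^ (t + 1)) * ∑' j, ENNReal.ofReal (r j ^ t) := ENNReal.tsum_mul_left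
      _ ≤ ENNReal.ofReal (2 * C ^ (t + 1)) * ENNReal.ofReal ε' := by gcongr
      _ = ENNReal.ofReal (2 * C ^ (t + 1) * ε') := (ENNReal.ofReal_mul (by positivity)).symm
      _ ≤ ENNReal.ofReal ε := ENNReal.ofReal_le_ofReal hε'3

/-- Adding a line raises the Hausdorff dimension by at most one. -/
lemma dimH_add_line_le (X : Set E) (e : E) :
    dimH (image2 (fun x (a : ℝ) => x + a • e) X univ) ≤ dimH X + 1 := by
  borelize E
  set Y := image2 (fun x (a : ℝ) => x + a • e) X (Icc 0 1) with hY
  have hYdim : dimH Y ≤ dimH X + 1 := by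
    refine dimH_le_of_forall_hausdorffMeasure_eq_zero fun t ht => ?_
    have h1 : (1 : ℝ≥0∞) < t := lt_of_le_of_lt (by simp) ht
    have h1' : (1 : ℝ≥0) < t := by exact_mod_cast h1
    obtain ⟨u, rfl⟩ := exists_add_of_le h1'.le
    rw [add_comm, ENNReal.coe_add, ENNReal.coe_one, add_comm] at ht
    have hu : dimH X < u := by
      rw [add_comm] at ht
      exact lt_of_add_lt_add_left ht
    have hu0 : (0 : ℝ) < u := by
      rcases eq_or_ne u 0 with h | h
      · simp [h] at hu
      · exact_mod_cast pos_iff_ne_zero.2 h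
    have := hausdorffMeasure_add_segment_eq_zero hu0 (hausdorffMeasure_of_dimH_lt hu) e
    rwa [NNReal.coe_add, add_comm, NNReal.coe_one]
  have hsub : image2 (fun x (a : ℝ) => x + a • e) X univ ⊆
      ⋃ m : ℤ, (IsometryEquiv.addRight ((m : ℝ) • e)) '' Y := by
    rintro _ ⟨x, hx, a, -, rfl⟩
    refine mem_iUnion.2 ⟨⌊a⌋, x + (Int.fract a) • e,
      mem_image2_of_mem hx ⟨Int.fract_nonneg a, (Int.fract_lt_one a).le⟩, ?_⟩
    simp only [IsometryEquiv.addRight_apply]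
    rw [add_assoc, ← add_smul, Int.fract_add_floor]
  refine (dimH_mono hsub).trans ?_
  rw [dimH_iUnion]
  refine iSup_le fun m => ?_
  rw [IsometryEquiv.dimH_image]
  exact hYdim

/-- Adding a finite-dimensional subspace raises the Hausdorff dimension by at most its dimension. -/
lemma dimH_add_submodule_le (X : Set E) (W : Submodule ℝ E) [FiniteDimensional ℝ W] :
    dimH (X + (W : Set E)) ≤ dimH X + Module.finrank ℝ W := by
  have key : ∀ (m : ℕ) (v : Fin m → E),
      dimH (X + (Submodule.span ℝ (range v) : Set E)) ≤ dimH X + m := by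
    intro m
    induction m with
    | zero => intro v; simp
    | succ m ih =>
      intro v
      have hsub : X + (Submodule.span ℝ (range v) : Set E) ⊆
          image2 (fun x (a : ℝ) => x + a • v 0)
            (X + (Submodule.span ℝ (range (Fin.tail v)) : Set E)) univ := by
        rintro _ ⟨x, hx, w, hw, rfl⟩
        have hr : range v = insert (v 0) (range (Fin.tail v)) := by
          rw [← Fin.range_cons, Fin.cons_self_tail]
        rw [hr, SetLike.mem_coe, Submodule.mem_span_insert] at hw
        obtain ⟨a, z, hz, rfl⟩ := hw
        refine ⟨x + z, add_mem_add hx hz, a, mem_univ _, ?_⟩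
        simp only []; abel
      calc _ ≤ _ := dimH_mono hsub
        _ ≤ _ := dimH_add_line_le _ _
        _ ≤ dimH X + m + 1 := by gcongr; exact ih _
        _ = _ := by push_cast; rw [add_assoc]
  set b := Module.finBasis ℝ W with hb
  have hspan : Submodule.span ℝ (range fun i => (b i : E)) = W := by
    have := congrArg (Submodule.map W.subtype) b.span_eq
    rw [Submodule.map_span, ← range_comp, Submodule.map_top, Submodule.range_subtype] at this
    exact this
  have := key _ fun i => (b i : E)
  rwa [hspan] at this

end AddSubspace

/-! ### Lower bounds: slicing along a subspace -/

section Slicing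

variable {E : Type*} [NormedAddCommGroup E] [InnerProductSpace ℝ E]
  (V : Submodule ℝ E) [FiniteDimensional ℝ V]

/-- If a `(t + dim V)`-null set contains a translate of a fixed ball of `V` at each point of
`D ⊆ Vᗮ`, then `D` is `t`-null. -/
lemma hausdorffMeasure_eq_zero_of_ball_subset [MeasurableSpace E] [BorelSpace E]
    {A D : Set E} {t : ℝ} (ht : 0 < t)
    (hA : μH[t + Module.finrank ℝ V] A = 0) (hD : ∀ z ∈ D, z ∈ Vᗮ) (v : V) {r : ℝ} (hr : 0 < r)
    (h : ∀ z ∈ D, ∀ u : V, dist u v < r → z + (u : E) ∈ A) : μH[t] D = 0 := by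
  refine hausdorffMeasure_eq_zero_of_cover ht.le fun ε hε => ?_
  set k := Module.finrank ℝ V with hk
  let : MeasurableSpace V := borel V
  have : BorelSpace V := ⟨rfl⟩
  let μ : Measure V := MeasureTheory.Measure.addHaar
  set c := (μ (Metric.ball 0 1)).toReal with hc
  set B := (μ (Metric.ball v r)).toReal with hB
  have hcfin : μ (Metric.ball 0 1) ≠ ∞ := Metric.isBounded_ball.measure_lt_top.ne
  have hBfin : μ (Metric.ball v r) ≠ ∞ := Metric.isBounded_ball.measure_lt_top.ne
  have hc0 : 0 < c := ENNReal.toReal_pos (Metric.measure_ball_pos μ _ one_pos).ne' hcfin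
  have hB0 : 0 < B := ENNReal.toReal_pos (Metric.measure_ball_pos μ _ hr).ne' hBfin
  obtain ⟨ε', hε'0, hε'1, hε'2⟩ : ∃ ε' : ℝ, 0 < ε' ∧ ε' ≤ ε ∧ c * ε' < ε * B := by
    refine ⟨min ε (ε * B / (2 * c)), by positivity, min_le_left _ _, ?_⟩
    calc c * min ε (ε * B / (2 * c)) ≤ c * (ε * B / (2 * c)) := by
          gcongr; exact min_le_right _ _
      _ = ε * B / 2 := by field_simp
      _ < ε * B := half_lt_self (by positivity)
  obtain ⟨U, ρ, hU, hρ, hd, hsum⟩ := exists_cover_of_hausdorffMeasure_eq_zero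
    (by positivity : 0 < t + (k : ℝ)) hA hε'0
  have hp : ∀ j, ∃ p : V, ∀ x ∈ U j, dist (V.orthogonalProjectionOnto x) p ≤ ρ j := by
    intro j
    rcases (U j).eq_empty_or_nonempty with h0 | ⟨y, hy⟩
    · exact ⟨0, by simp [h0]⟩
    · refine ⟨V.orthogonalProjectionOnto y, fun x hx => ?_⟩
      have h1 := (Metric.edist_le_ediam_of_mem hx hy).trans (hd j)
      rw [edist_dist, ENNReal.ofReal_le_ofReal_iff (hρ j).1.le] at h1
      have h2 := V.lipschitzWith_orthogonalProjectionOnto.dist_le_mul x y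
      simp only [NNReal.coe_one, one_mul] at h2
      exact h2.trans h1
  choose p hp using hp
  -- `g u` is the total t-size of the covering sets that can meet the slice over u. Its integral is
  -- c ∑ ρ_j^(t+k), which is small, so some u in the fixed ball has a cheap slice; projecting that
  -- slice to Vᗮ covers D.
  set g : V → ℝ≥0∞ := fun u =>
    ∑' j, (Metric.closedBall (p j) (ρ j)).indicator (fun _ => ENNReal.ofReal (ρ j ^ t)) u with hg
  have hint : ∫⁻ u, g u ∂μ ≤ ENNReal.ofReal (c * ε') := by
    rw [hg, lintegral_tsum fun j =>
      (measurable_const.indicator Metric.isClosed_closedBall.measurableSet).aemeasurable]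
    calc ∑' j, ∫⁻ u, (Metric.closedBall (p j) (ρ j)).indicator
            (fun _ => ENNReal.ofReal (ρ j ^ t)) u ∂μ
        = ∑' j, ENNReal.ofReal c * ENNReal.ofReal (ρ j ^ (t + (k : ℝ))) := by
          refine tsum_congr fun j => ?_
          rw [lintegral_indicator Metric.isClosed_closedBall.measurableSet, setLIntegral_const,
            Measure.addHaar_closedBall _ _ (hρ j).1.le, ← ENNReal.ofReal_toReal hcfin, ← hc, ← hk,
            ← ENNReal.ofReal_mul (by have := (hρ j).1; positivity),
            ← ENNReal.ofReal_mul (by have := (hρ j).1; positivity),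
            ← ENNReal.ofReal_mul (by positivity), Real.rpow_add (hρ j).1, Real.rpow_natCast]
          congr 1; ring
      _ = ENNReal.ofReal c * ∑' j, ENNReal.ofReal (ρ j ^ (t + (k : ℝ))) := ENNReal.tsum_mul_left
      _ ≤ ENNReal.ofReal c * ENNReal.ofReal ε' := by gcongr
      _ = _ := (ENNReal.ofReal_mul hc0.le).symm
  obtain ⟨u, hu, hgu⟩ : ∃ u : V, dist u v < r ∧ g u ≤ ENNReal.ofReal ε := by
    by_contra! hcon
    have h1 : ENNReal.ofReal (ε * B) ≤ ∫⁻ u, g u ∂μ := by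
      rw [ENNReal.ofReal_mul hε.le, hB, ENNReal.ofReal_toReal hBfin, ← setLIntegral_const]
      exact (setLIntegral_mono' Metric.isOpen_ball.measurableSet
        fun u hu => (hcon u hu).le).trans (setLIntegral_le_lintegral _ _)
    have h2 := h1.trans hint
    rw [ENNReal.ofReal_le_ofReal_iff (by positivity)] at h2
    linarith
  refine ⟨{j // u ∈ Metric.closedBall (p j) (ρ j)}, inferInstance,
    fun j => Vᗮ.starProjection '' U j, fun j => ρ j, ?_, ?_, ?_, ?_⟩
  · intro z hz
    obtain ⟨j, hj⟩ := mem_iUnion.1 (hU (h z hz u hu))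
    have h1 : V.orthogonalProjectionOnto (z + (u : E)) = u := by
      rw [map_add, V.orthogonalProjectionOnto_apply_of_mem_orthogonal (hD z hz)]
      simp
    have h2 : Vᗮ.starProjection (z + (u : E)) = z := by
      rw [map_add, Submodule.starProjection_eq_self_iff.2 (hD z hz),
        V.starProjection_orthogonal_apply_eq_zero u.2, add_zero]
    refine mem_iUnion.2 ⟨⟨j, ?_⟩, z + u, hj, h2⟩
    have := hp j _ hj
    rwa [h1] at this
  · exact fun j => ⟨(hρ j).1.le, (hρ j).2.trans hε'1⟩
  · intro j
    have h1 := Vᗮ.lipschitzWith_starProjection.ediam_image_le (U j)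
    simp only [ENNReal.coe_one, one_mul] at h1
    exact h1.trans (hd j)
  · refine le_trans (le_of_eq ?_) hgu
    refine (tsum_subtype {j | u ∈ Metric.closedBall (p j) (ρ j)}
      fun j => ENNReal.ofReal (ρ j ^ t)).trans ?_
    rw [hg]
    exact tsum_congr fun j => by simp only [indicator, mem_ofPred_eq]

/-- A set containing a ball of `V` above each point of `D ⊆ Vᗮ` has Hausdorff dimension at least
`dimH D + dim V`. -/
lemma dimH_add_finrank_le_of_ball_subset {A D : Set E} (hne : D.Nonempty)
    (h : ∀ z ∈ D, z ∈ Vᗮ ∧ ∃ v : V, ∃ r : ℝ, 0 < r ∧ ∀ u : V, dist u v < r → z + (u : E) ∈ A) :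
    dimH D + Module.finrank ℝ V ≤ dimH A := by
  borelize E
  have hkA : (Module.finrank ℝ V : ℝ≥0∞) ≤ dimH A := by
    obtain ⟨z, hz⟩ := hne
    obtain ⟨-, v, r, hr, hA⟩ := h z hz
    rw [← Real.dimH_of_mem_nhds (Metric.ball_mem_nhds v hr)]
    have hiso : Isometry fun u : V => z + (u : E) :=
      (isometry_add_left z).comp isometry_subtype_coe
    rw [← hiso.dimH_image]
    refine dimH_mono ?_
    rintro _ ⟨u, hu, rfl⟩
    exact hA u hu
  suffices hD : dimH D ≤ dimH A - Module.finrank ℝ V by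
    calc _ ≤ dimH A - Module.finrank ℝ V + Module.finrank ℝ V := by gcongr
      _ = _ := tsub_add_cancel_of_le hkA
  refine dimH_le_of_forall_hausdorffMeasure_eq_zero fun t ht => ?_
  have ht0 : (0 : ℝ) < t := by
    have : (0 : ℝ≥0∞) < t := bot_le.trans_lt ht
    exact_mod_cast this
  have hAt : μH[(t : ℝ) + Module.finrank ℝ V] A = 0 := by
    have h1 : dimH A < ((t + (Module.finrank ℝ V : ℝ≥0) : ℝ≥0) : ℝ≥0∞) := by
      push_cast
      exact ENNReal.sub_lt_iff_lt_right (by simp) hkA |>.1 ht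
    simpa using hausdorffMeasure_of_dimH_lt h1
  -- The ball depends on z. Shrinking it to a center in a dense sequence and radius 1/(m+1) leaves
  -- countably many cases, each with a fixed ball.
  have hcover : D ⊆ ⋃ q : ℕ × ℕ, {z ∈ D | ∀ u : V,
      dist u (TopologicalSpace.denseSeq V q.1) < 1 / ((q.2 : ℝ) + 1) → z + (u : E) ∈ A} := by
    intro z hz
    obtain ⟨-, v, r, hr, hA⟩ := h z hz
    obtain ⟨m, hm⟩ := exists_nat_one_div_lt (half_pos hr)
    obtain ⟨i, hi⟩ := (TopologicalSpace.denseRange_denseSeq V).exists_dist_lt v (half_pos hr)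
    refine mem_iUnion.2 ⟨(i, m), hz, fun u hu => hA u ?_⟩
    calc dist u v ≤ dist u _ + dist _ v := dist_triangle _ (TopologicalSpace.denseSeq V i) _
      _ < r / 2 + r / 2 := add_lt_add (hu.trans hm) (by rwa [dist_comm])
      _ = r := add_halves r
  refine measure_mono_null hcover (measure_iUnion_null fun q => ?_)
  exact hausdorffMeasure_eq_zero_of_ball_subset V ht0 hAt (fun z hz => (h z hz.1).1) _
    (by positivity : 0 < 1 / ((q.2 : ℝ) + 1)) fun z hz u hu => hz.2 u hu

end Slicing

/-! ### Super-exponentially decreasing scales -/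

section Scales

open scoped Nat

/-- The rapidly decreasing sequence of scales of the Cantor construction in `ℝⁿ`. -/
noncomputable def cantorScale (n j : ℕ) : ℝ := ((4 * n : ℝ)⁻¹) ^ (j + 1)!

variable {n : ℕ}

lemma cantorScale_pos (hn : 0 < n) (j : ℕ) : 0 < cantorScale n j := by
  unfold cantorScale; positivity

lemma four_le_four_mul (hn : 0 < n) : (4 : ℝ) ≤ 4 * n := by
  have : (1 : ℝ) ≤ n := by exact_mod_cast hn
  linarith

lemma inv_four_mul_lt_one (hn : 0 < n) : (4 * n : ℝ)⁻¹ < 1 :=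
  inv_lt_one_of_one_lt₀ (by linarith [four_le_four_mul hn])

lemma cantorScale_le_inv (hn : 0 < n) (j : ℕ) : cantorScale n j ≤ (4 * n : ℝ)⁻¹ :=
  pow_le_of_le_one (by positivity) (inv_four_mul_lt_one hn).le (Nat.factorial_ne_zero _)

lemma cantorScale_lt_one (hn : 0 < n) (j : ℕ) : cantorScale n j < 1 :=
  (cantorScale_le_inv hn j).trans_lt (inv_four_mul_lt_one hn)

/-- The exponent j + 2 is unbounded, so each scale is eventually below any fixed power of the
previous one. This makes the choice of earlier digits free when covering at the next scale. -/
lemma cantorScale_succ (j : ℕ) : cantorScale n (j + 1) = cantorScale n j ^ (j + 2) := by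
  rw [cantorScale, cantorScale, ← pow_mul, Nat.factorial_succ (j + 1), mul_comm (j + 1 + 1)]

lemma mul_cantorScale_succ_le (hn : 0 < n) (j : ℕ) :
    4 * n * cantorScale n (j + 1) ≤ cantorScale n j := by
  have h0 := cantorScale_pos hn j
  have hB : (0 : ℝ) < 4 * n := by linarith [four_le_four_mul hn]
  calc 4 * n * cantorScale n (j + 1)
      = 4 * n * (cantorScale n j * cantorScale n j ^ (j + 1)) := by
        rw [cantorScale_succ, ← pow_succ']
    _ ≤ 4 * n * (cantorScale n j * (4 * n : ℝ)⁻¹) := by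
        gcongr
        exact (pow_le_of_le_one h0.le (cantorScale_lt_one hn j).le (by omega)).trans
          (cantorScale_le_inv hn j)
    _ = cantorScale n j := by field_simp

lemma cantorScale_add_le (hn : 0 < n) (j i : ℕ) :
    cantorScale n (i + j) ≤ cantorScale n j * (1 / 2) ^ i := by
  induction i with
  | zero => simp
  | succ i ih =>
    have h1 := mul_cantorScale_succ_le hn (i + j)
    have h2 := cantorScale_pos hn (i + j + 1)
    have h3 : 4 * cantorScale n (i + j + 1) ≤ cantorScale n (i + j) :=
      (mul_le_mul_of_nonneg_right (four_le_four_mul hn) h2.le).trans h1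
    rw [show i + 1 + j = i + j + 1 by ring, pow_succ]
    linarith

lemma cantorScale_antitone (hn : 0 < n) : Antitone (cantorScale n) :=
  antitone_nat_of_succ_le fun j => by
    have h1 := mul_cantorScale_succ_le hn j
    have h2 := cantorScale_pos hn (j + 1)
    nlinarith [four_le_four_mul hn]

lemma tendsto_cantorScale (hn : 0 < n) : Tendsto (cantorScale n) atTop (𝓝 0) := by
  refine squeeze_zero (fun j => (cantorScale_pos hn j).le) (fun j => cantorScale_add_le hn 0 j) ?_
  simpa using (tendsto_pow_atTop_nhds_zero_of_lt_one (by norm_num : (0 : ℝ) ≤ 1 / 2)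
    (by norm_num)).const_mul (cantorScale n 0)

/-- The scales decrease faster than any geometric sequence, even after taking powers. -/
lemma tendsto_pow_mul_cantorScale_rpow (hn : 0 < n) {G η : ℝ} (hG : 0 < G) (hη : 0 < η) :
    Tendsto (fun j => G ^ (j + 1) * cantorScale n j ^ η) atTop (𝓝 0) := by
  set a := ((4 * n : ℝ)⁻¹) ^ η with ha
  have ha0 : 0 < a := by have := inv_four_mul_lt_one hn; positivity
  have ha1 : a < 1 := Real.rpow_lt_one (by positivity) (inv_four_mul_lt_one hn) hη
  have hform : ∀ j, G ^ (j + 1) * cantorScale n j ^ η = (G * a ^ j !) ^ (j + 1) := by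
    intro j
    rw [cantorScale, ← Real.rpow_pow_comm (by positivity), ← ha, Nat.factorial_succ,
      mul_comm (j + 1), pow_mul, mul_pow]
  have hlim : Tendsto (fun j : ℕ => G * a ^ j !) atTop (𝓝 0) := by
    have h1 : Tendsto (fun j : ℕ => a ^ j !) atTop (𝓝 0) :=
      (tendsto_pow_atTop_nhds_zero_of_lt_one ha0.le ha1).comp
        (tendsto_atTop_mono Nat.self_le_factorial tendsto_id)
    simpa using h1.const_mul G
  have hev : ∀ᶠ j : ℕ in atTop, G * a ^ j ! < 1 / 2 := hlim.eventually (gt_mem_nhds (by norm_num))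
  refine squeeze_zero' (Eventually.of_forall fun j => by
    have := cantorScale_pos hn j; positivity) (g := fun j : ℕ => (1 / 2 : ℝ) ^ (j + 1)) ?_
    ((tendsto_add_atTop_iff_nat 1).2 (tendsto_pow_atTop_nhds_zero_of_lt_one (by norm_num)
      (by norm_num)))
  filter_upwards [hev] with j hj
  rw [hform]
  gcongr

/-- Each scale is negligible compared to any power of the previous one. -/
lemma tendsto_cantorScale_succ_rpow_mul (hn : 0 < n) (m : ℕ) {η : ℝ} (hη : 0 < η) :
    Tendsto (fun j => cantorScale n (j + 1) ^ η * ((cantorScale n j)⁻¹) ^ m) atTop (𝓝 0) := by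
  refine squeeze_zero' (Eventually.of_forall fun j => by
    have := cantorScale_pos hn j; have := cantorScale_pos hn (j + 1); positivity)
    (g := cantorScale n) ?_ (tendsto_cantorScale hn)
  obtain ⟨J, hJ⟩ := exists_nat_gt ((m + 1) / η)
  filter_upwards [eventually_ge_atTop J] with j hj
  have h0 := cantorScale_pos hn j
  have h1 := (cantorScale_lt_one hn j).le
  have hexp : (m : ℝ) + 1 ≤ ((j + 2 : ℕ) : ℝ) * η := by
    rw [div_lt_iff₀ hη] at hJ
    have : (J : ℝ) ≤ ((j + 2 : ℕ) : ℝ) := by exact_mod_cast (by omega)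
    nlinarith
  rw [cantorScale_succ, ← Real.rpow_natCast, ← Real.rpow_mul h0.le, inv_pow, ← div_eq_mul_inv,
    div_le_iff₀ (by positivity)]
  calc cantorScale n j ^ (((j + 2 : ℕ) : ℝ) * η) ≤ cantorScale n j ^ ((m : ℝ) + 1) :=
        Real.rpow_le_rpow_of_exponent_ge h0 h1 hexp
    _ = _ := by rw [Real.rpow_add_one h0.ne', Real.rpow_natCast, mul_comm]

/-- The ratio of consecutive scales, up to a constant. -/
noncomputable def cantorRatio (n j : ℕ) : ℝ := cantorScale n j / (4 * n * cantorScale n (j + 1))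

lemma one_le_cantorRatio (hn : 0 < n) (j : ℕ) : 1 ≤ cantorRatio n j := by
  have := cantorScale_pos hn (j + 1)
  rw [cantorRatio, one_le_div (by positivity)]
  exact mul_cantorScale_succ_le hn j

lemma cantorRatio_le (hn : 0 < n) (j : ℕ) :
    cantorRatio n j ≤ cantorScale n j / cantorScale n (j + 1) := by
  have h0 := cantorScale_pos hn j
  have h1 := cantorScale_pos hn (j + 1)
  rw [cantorRatio]
  gcongr
  nlinarith [four_le_four_mul hn]

/-- The product telescopes. It controls the number of digit strings before stage j. -/
lemma prod_cantorRatio_le (hn : 0 < n) (j : ℕ) :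
    ∏ l ∈ Finset.range j, cantorRatio n l ≤ (cantorScale n j)⁻¹ := by
  have hle : ∏ l ∈ Finset.range j, cantorRatio n l ≤ cantorScale n 0 / cantorScale n j := by
    induction j with
    | zero => simp [(cantorScale_pos hn 0).ne']
    | succ j ih =>
      have h0 := cantorScale_pos hn j
      have h1 := cantorScale_pos hn (j + 1)
      have h2 := cantorScale_pos hn 0
      rw [Finset.prod_range_succ]
      calc _ ≤ cantorScale n 0 / cantorScale n j * (cantorScale n j / cantorScale n (j + 1)) :=
            mul_le_mul ih (cantorRatio_le hn j) (zero_le_one.trans (one_le_cantorRatio hn j))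
              (by positivity)
        _ = _ := by field_simp
  refine hle.trans ?_
  rw [div_eq_mul_inv]
  exact mul_le_of_le_one_left (by have := cantorScale_pos hn j; positivity)
    (cantorScale_lt_one hn 0).le

end Scales

/-! ### Digit expansions and the upper bound on dimension -/

section Digits

/-- The number of digits available at stage `q.1` in the coordinate direction `q.2`. -/
noncomputable def digitCount (n : ℕ) (α : Fin n → ℝ) (q : ℕ × Fin n) : ℕ :=
  ⌊cantorRatio n q.1 ^ α q.2⌋₊

/-- The space of digit expansions. -/
abbrev DigitSpace (n : ℕ) (α : Fin n → ℝ) : Type := ∀ q : ℕ × Fin n, Fin (digitCount n α q)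

variable {n : ℕ} {α : Fin n → ℝ}

lemma digitCount_pos (hn : 0 < n) (h0 : ∀ m, 0 ≤ α m) (q : ℕ × Fin n) : 0 < digitCount n α q :=
  Nat.floor_pos.2 (Real.one_le_rpow (one_le_cantorRatio hn _) (h0 _))

lemma digitCount_le_rpow (hn : 0 < n) (q : ℕ × Fin n) :
    (digitCount n α q : ℝ) ≤ cantorRatio n q.1 ^ α q.2 :=
  Nat.floor_le (by have := one_le_cantorRatio hn q.1; positivity)

/-- Consecutive digits at stage j are thus at least 4n times the next scale apart, twice what the
later stages can contribute along unit vectors. -/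
lemma digitCount_le_ratio (hn : 0 < n) (h1 : ∀ m, α m ≤ 1) (q : ℕ × Fin n) :
    (digitCount n α q : ℝ) ≤ cantorRatio n q.1 :=
  (digitCount_le_rpow hn q).trans
    ((Real.rpow_le_rpow_of_exponent_le (one_le_cantorRatio hn _) (h1 _)).trans
      (Real.rpow_one _).le)

/-- The factor 2 is the cost of the floor: a real number y ≥ 1 has floor at least y/2. -/
lemma inv_digitCount_le (hn : 0 < n) (h0 : ∀ m, 0 ≤ α m) (q : ℕ × Fin n) :
    (digitCount n α q : ℝ)⁻¹ ≤ 2 * ((cantorRatio n q.1)⁻¹) ^ α q.2 := by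
  have hpos : (1 : ℝ) ≤ digitCount n α q := by exact_mod_cast digitCount_pos hn h0 q
  have hN := one_le_cantorRatio hn q.1
  have hlt := Nat.lt_floor_add_one (cantorRatio n q.1 ^ α q.2)
  have hM : (⌊cantorRatio n q.1 ^ α q.2⌋₊ : ℝ) = digitCount n α q := rfl
  rw [Real.inv_rpow (by positivity), inv_le_iff_one_le_mul₀ (by positivity)]
  have hr : 0 < cantorRatio n q.1 ^ α q.2 := by positivity
  rw [mul_right_comm, ← div_eq_mul_inv, one_le_div hr]
  linarith

/-- If, for infinitely many stages `j`, the digits of stages before `j` and the digits of stage `j`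
in the directions from `p` on determine `g` up to a multiple of the next scale, then the dimension
of the range of `g` is at most the sum of the exponents of the directions from `p` on. -/
lemma dimH_range_le_of_digits {Y : Type*} [MetricSpace Y] (hn : 0 < n) (h0 : ∀ m, 0 ≤ α m)
    (h1 : ∀ m, α m ≤ 1) (p : ℕ) (g : DigitSpace n α → Y) (C : ℝ)
    (h : ∃ᶠ j in atTop, ∀ c c' : DigitSpace n α, (∀ q, q.1 < j → c q = c' q) →
      (∀ m : Fin n, p ≤ m → c (j, m) = c' (j, m)) →
      dist (g c) (g c') ≤ C * cantorScale n (j + 1)) :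
    dimH (range g) ≤ ENNReal.ofReal (∑ m with p ≤ (m : Fin n).val, α m) := by
  borelize Y
  set β := ∑ m with p ≤ (m : Fin n).val, α m with hβ
  have hβ0 : 0 ≤ β := Finset.sum_nonneg fun m _ => h0 m
  refine dimH_le_of_forall_hausdorffMeasure_eq_zero fun t ht => ?_
  have ht' : β < t := by
    rw [← ENNReal.ofReal_coe_nnreal, ENNReal.ofReal_lt_ofReal_iff_of_nonneg hβ0] at ht
    exact ht
  refine hausdorffMeasure_eq_zero_of_cover t.2 fun ε hε => ?_
  set D : ℝ := max C 1 with hD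
  have hD0 : 0 < D := lt_of_lt_of_le one_pos (le_max_right _ _)
  have hlim1 : Tendsto (fun j => D * cantorScale n (j + 1)) atTop (𝓝 0) := by
    simpa using ((tendsto_add_atTop_iff_nat 1).2 (tendsto_cantorScale hn)).const_mul D
  have hlim2 : Tendsto (fun j => D ^ (t : ℝ) * (cantorScale n (j + 1) ^ ((t : ℝ) - β) *
      ((cantorScale n j)⁻¹) ^ n)) atTop (𝓝 0) := by
    simpa using (tendsto_cantorScale_succ_rpow_mul hn n (sub_pos.2 ht')).const_mul (D ^ (t : ℝ))
  obtain ⟨j, hj, hj1, hj2⟩ := (h.and_eventually ((hlim1.eventually (ge_mem_nhds hε)).and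
    (hlim2.eventually (ge_mem_nhds hε)))).exists
  have hδ := cantorScale_pos hn j
  have hδ' := cantorScale_pos hn (j + 1)
  -- The cover consists of the images of the cylinders that fix the coordinates in I; by the choice
  -- of j each has diameter comparable to the next scale.
  set I : Finset (ℕ × Fin n) := (Finset.range j ×ˢ Finset.univ) ∪
    ({j} ×ˢ Finset.univ.filter fun m : Fin n => p ≤ m.val) with hI
  refine ⟨∀ q : I, Fin (digitCount n α q), inferInstance,
    fun a => g '' {c | ∀ q : I, c q = a q}, fun _ => D * cantorScale n (j + 1), ?_, ?_, ?_, ?_⟩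
  · rintro _ ⟨c, rfl⟩
    exact mem_iUnion.2 ⟨fun q => c q, c, fun _ => rfl, rfl⟩
  · exact fun _ => ⟨by positivity, hj1⟩
  · intro a
    refine Metric.ediam_le ?_
    rintro _ ⟨c, hc, rfl⟩ _ ⟨c', hc', rfl⟩
    rw [edist_dist]
    refine ENNReal.ofReal_le_ofReal ((hj c c' ?_ ?_).trans ?_)
    · intro q hq
      have hqI : q ∈ I := by simp [hI, hq]
      exact (hc ⟨q, hqI⟩).trans (hc' ⟨q, hqI⟩).symm
    · intro m hm
      have hqI : (j, m) ∈ I := by simp [hI, hm]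
      exact (hc ⟨_, hqI⟩).trans (hc' ⟨_, hqI⟩).symm
    · exact mul_le_mul_of_nonneg_right (le_max_left _ _) hδ'.le
  · rw [tsum_fintype, Finset.sum_const, Finset.card_univ, nsmul_eq_mul, ← ENNReal.ofReal_natCast,
      ← ENNReal.ofReal_mul (by positivity)]
    refine ENNReal.ofReal_le_ofReal (le_trans ?_ hj2)
    -- Each direction before stage j counts with exponent at most 1, giving δ_j^(-n), and stage j
    -- gives at most δ_(j+1)^(-β). Times δ_(j+1)^t, the total tends to 0 because t > β.
    have hcard : (Fintype.card (∀ q : I, Fin (digitCount n α q)) : ℝ) ≤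
        ((cantorScale n j)⁻¹) ^ n * ((cantorScale n (j + 1))⁻¹) ^ β := by
      rw [Fintype.card_pi]
      simp only [Fintype.card_fin]
      rw [Finset.prod_coe_sort I (fun q => digitCount n α q), hI, Finset.prod_union, Nat.cast_mul,
        Finset.prod_product, Finset.prod_product]
      · refine mul_le_mul ?_ ?_ (by positivity) (by positivity)
        · push_cast
          calc ∏ l ∈ Finset.range j, ∏ m : Fin n, (digitCount n α (l, m) : ℝ)
              ≤ ∏ l ∈ Finset.range j, cantorRatio n l ^ n := by
                refine Finset.prod_le_prod (fun l _ => by positivity) fun l _ => ?_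
                refine (Finset.prod_le_prod (fun m _ => by positivity)
                  fun m _ => digitCount_le_ratio hn h1 (l, m)).trans ?_
                simp
            _ ≤ _ := by
                rw [Finset.prod_pow]
                have : ∀ l ∈ Finset.range j, 0 ≤ cantorRatio n l := fun l _ =>
                  zero_le_one.trans (one_le_cantorRatio hn l)
                exact pow_le_pow_left₀ (Finset.prod_nonneg this) (prod_cantorRatio_le hn j) n
        · have hN := one_le_cantorRatio hn j
          rw [Finset.prod_singleton]
          push_cast
          calc ∏ m with p ≤ (m : Fin n).val, (digitCount n α (j, m) : ℝ)
              ≤ ∏ m with p ≤ (m : Fin n).val, cantorRatio n j ^ α m :=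
                Finset.prod_le_prod (fun m _ => by positivity) fun m _ => digitCount_le_rpow hn (j, m)
            _ = cantorRatio n j ^ β := (Real.rpow_sum_of_pos (by positivity) _ _).symm
            _ ≤ _ := by
                gcongr
                refine (cantorRatio_le hn j).trans ?_
                rw [div_eq_mul_inv]
                exact mul_le_of_le_one_left (by positivity) (cantorScale_lt_one hn j).le
      · rw [Finset.disjoint_left]
        rintro ⟨l, m⟩ hl hl'
        simp only [Finset.mem_product, Finset.mem_range, Finset.mem_singleton] at hl hl'
        omega
    calc _ ≤ ((cantorScale n j)⁻¹) ^ n * ((cantorScale n (j + 1))⁻¹) ^ β *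
          (D * cantorScale n (j + 1)) ^ (t : ℝ) :=
          mul_le_mul_of_nonneg_right hcard (by positivity)
      _ = _ := by
        rw [Real.mul_rpow hD0.le hδ'.le, Real.inv_rpow hδ'.le, Real.rpow_sub hδ']
        ring

end Digits

/-! ### The uniform measure on digit expansions -/

section DigitMeasure

variable {n : ℕ} {α : Fin n → ℝ}

/-- The proportion, out of `M` digits, of those at distance at most `σ * M` from a given digit. -/
lemma uniformOn_univ_near_le {M : ℕ} [NeZero M] (a : Fin M) {σ : ℝ} (hσ : 0 ≤ σ) :
    ProbabilityTheory.uniformOn univ {x : Fin M | |(x : ℝ) - a| / M ≤ σ} ≤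
      ENNReal.ofReal (2 * σ + (M : ℝ)⁻¹) := by
  have hM : (0 : ℝ) < M := by exact_mod_cast Nat.pos_of_ne_zero (NeZero.ne M)
  have hcount : (({x : Fin M | |(x : ℝ) - a| / M ≤ σ}.toFinset).card : ℝ) ≤ 2 * (σ * M) + 1 := by
    set s := {x : Fin M | |(x : ℝ) - a| / M ≤ σ}.toFinset with hs
    set k := ⌊σ * M⌋₊ with hk
    have hsub : s.card ≤ (Finset.Icc ((a : ℤ) - k) (a + k)).card := by
      refine Finset.card_le_card_of_injOn (fun x : Fin M => (x : ℤ)) ?_ ?_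
      · intro x hx
        have hx' : |(x : ℝ) - a| ≤ σ * M := by
          have : x ∈ s := hx
          rw [hs, Set.mem_toFinset] at this
          exact (div_le_iff₀ hM).1 this
        have h2 : |(x : ℤ) - a| ≤ k := by
          have : ((|(x : ℤ) - a|).toNat : ℕ) ≤ k := by
            refine Nat.le_floor ?_
            have h3 : (((|(x : ℤ) - a|).toNat : ℤ) : ℝ) = |(x : ℝ) - a| := by
              rw [Int.toNat_of_nonneg (abs_nonneg _)]; push_cast; rfl
            rw [Int.cast_natCast] at h3
            rwa [h3]
          omega
        rw [abs_le] at h2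
        simp only [Finset.coe_Icc, mem_Icc]
        constructor <;> linarith [h2.1, h2.2]
      · intro x _ y _ hxy
        simpa [Fin.ext_iff] using hxy
    have h4 : (Finset.Icc ((a : ℤ) - k) (a + k)).card = 2 * k + 1 := by
      rw [Int.card_Icc]; omega
    rw [h4] at hsub
    have h5 : (k : ℝ) ≤ σ * M := Nat.floor_le (by positivity)
    have h6 : (s.card : ℝ) ≤ 2 * k + 1 := by exact_mod_cast hsub
    linarith
  rw [ProbabilityTheory.uniformOn_univ, Measure.count_apply (MeasurableSet.of_discrete),
    Set.encard_eq_coe_toFinset_card, Fintype.card_fin]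
  rw [ENat.toENNReal_coe, ← ENNReal.ofReal_natCast, ← ENNReal.ofReal_natCast,
    ← ENNReal.ofReal_div_of_pos hM]
  refine ENNReal.ofReal_le_ofReal ?_
  rw [div_le_iff₀ hM]
  calc _ ≤ 2 * (σ * M) + 1 := hcount
    _ = _ := by field_simp

lemma uniformOn_univ_singleton {M : ℕ} [NeZero M] (a : Fin M) :
    ProbabilityTheory.uniformOn univ {a} = ENNReal.ofReal (M : ℝ)⁻¹ := by
  have hM : (0 : ℝ) < M := by exact_mod_cast Nat.pos_of_ne_zero (NeZero.ne M)
  rw [ProbabilityTheory.uniformOn_univ, Measure.count_singleton, Fintype.card_fin,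
    ENNReal.ofReal_inv_of_pos hM, ENNReal.ofReal_natCast, one_div]

/-- The product of the uniform measures on the digits. -/
noncomputable def digitMeasure (n : ℕ) (α : Fin n → ℝ) : Measure (DigitSpace n α) :=
  Measure.infinitePi fun _ => ProbabilityTheory.uniformOn univ

/-- Near digits at stage `j`, at any resolution `ρ` between two consecutive scales. -/
lemma uniformOn_univ_digit_le (hn : 0 < n) (h0 : ∀ m, 0 ≤ α m) (h1 : ∀ m, α m ≤ 1) (j : ℕ)
    (m : Fin n) {ρ : ℝ} (hρ : 2 * n * cantorScale n (j + 1) ≤ ρ) (a : Fin (digitCount n α (j, m))) :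
    ProbabilityTheory.uniformOn univ {x : Fin (digitCount n α (j, m)) |
      cantorScale n j * (|(x : ℝ) - a| / digitCount n α (j, m)) ≤ 2 * ρ} ≤
      ENNReal.ofReal (3 * (4 * ρ / cantorScale n j) ^ α m) := by
  have hδ := cantorScale_pos hn j
  have hδ' := cantorScale_pos hn (j + 1)
  have hn' : (0 : ℝ) < n := by exact_mod_cast hn
  have hρ0 : 0 < ρ := lt_of_lt_of_le (by positivity) hρ
  have : NeZero (digitCount n α (j, m)) := ⟨(digitCount_pos hn h0 _).ne'⟩
  set τ := 4 * ρ / cantorScale n j with hτ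
  have hτ0 : 0 < τ := by positivity
  -- For τ ≤ 1 both contributions are absorbed: τ ≤ τ^α, and the reciprocal of the digit count is at
  -- most 2 τ^α. For τ ≥ 1 the bound exceeds 1 and is trivial.
  rcases le_total τ 1 with hτ1 | hτ1
  · have hset : {x : Fin (digitCount n α (j, m)) |
        cantorScale n j * (|(x : ℝ) - a| / digitCount n α (j, m)) ≤ 2 * ρ} =
        {x : Fin (digitCount n α (j, m)) | |(x : ℝ) - a| / digitCount n α (j, m) ≤ τ / 2} := by
      ext x
      simp only [mem_ofPred_eq]
      rw [← le_div_iff₀' hδ]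
      have : 2 * ρ / cantorScale n j = τ / 2 := by rw [hτ]; ring
      rw [this]
    rw [hset]
    refine (uniformOn_univ_near_le a (by positivity)).trans (ENNReal.ofReal_le_ofReal ?_)
    have hτα : τ ≤ τ ^ α m := by
      simpa using Real.rpow_le_rpow_of_exponent_ge hτ0 hτ1 (h1 m)
    have hinv : (digitCount n α (j, m) : ℝ)⁻¹ ≤ 2 * τ ^ α m := by
      refine (inv_digitCount_le hn h0 (j, m)).trans ?_
      have hr : (cantorRatio n j)⁻¹ ≤ τ := by
        rw [cantorRatio, inv_div, hτ]
        exact div_le_div_of_nonneg_right (by linarith) hδ.le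
      have := one_le_cantorRatio hn j
      gcongr
      exact h0 m
    linarith
  · refine prob_le_one.trans ?_
    rw [← ENNReal.ofReal_one]
    refine ENNReal.ofReal_le_ofReal ?_
    have := Real.one_le_rpow hτ1 (h0 m)
    linarith

/-- The measure of a set of digit expansions that agree before stage `j` and are near each other at
stage `j`. -/
lemma digitMeasure_le (hn : 0 < n) (h0 : ∀ m, 0 ≤ α m) (h1 : ∀ m, α m ≤ 1) :
    ∃ G : ℝ, 0 < G ∧ ∀ (j : ℕ) (ρ : ℝ), 2 * n * cantorScale n (j + 1) ≤ ρ →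
      ∀ (c : DigitSpace n α) (S : Set (DigitSpace n α)),
      (∀ c' ∈ S, (∀ q, q.1 < j → c' q = c q) ∧ ∀ m, cantorScale n j *
        (|((c' (j, m) : ℕ) : ℝ) - (c (j, m) : ℕ)| / digitCount n α (j, m)) ≤ 2 * ρ) →
      digitMeasure n α S ≤ ENNReal.ofReal (G ^ (j + 1) * ρ ^ ∑ m, α m) := by
  have hn' : (0 : ℝ) < n := by exact_mod_cast hn
  set d := ∑ m, α m with hd
  have hd0 : 0 ≤ d := Finset.sum_nonneg fun m _ => h0 m
  have hne : ∀ q, NeZero (digitCount n α q) := fun q => ⟨(digitCount_pos hn h0 _).ne'⟩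
  -- A is the loss per stage before j, from the floors and from the factor 4n in the ratios; B is
  -- the loss of stage j and of the initial scale. The powers of δ_j cancel, leaving A^j B ρ^d.
  set A : ℝ := 2 ^ n * (4 * n) ^ d with hA
  set B : ℝ := 3 ^ n * (4 / cantorScale n 0) ^ d with hB
  have hδ0 := cantorScale_pos hn 0
  have hA1 : 1 ≤ A := one_le_mul_of_one_le_of_one_le (one_le_pow₀ (by norm_num))
    (Real.one_le_rpow (by linarith [four_le_four_mul hn]) hd0)
  have hB1 : 1 ≤ B := by
    refine one_le_mul_of_one_le_of_one_le (one_le_pow₀ (by norm_num)) (Real.one_le_rpow ?_ hd0)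
    rw [one_le_div hδ0]
    linarith [cantorScale_lt_one hn 0]
  refine ⟨A * B, by positivity, fun j ρ hρ c S hS => ?_⟩
  have hδ := cantorScale_pos hn j
  have hδ' := cantorScale_pos hn (j + 1)
  have hρ0 : 0 < ρ := lt_of_lt_of_le (by positivity) hρ
  set T : (q : ℕ × Fin n) → Set (Fin (digitCount n α q)) := fun q =>
    if q.1 < j then {c q} else {x | cantorScale n j *
      (|(x : ℝ) - (c q : ℕ)| / digitCount n α q) ≤ 2 * ρ} with hT
  have hsub : S ⊆ Set.pi ((Finset.range (j + 1) ×ˢ Finset.univ : Finset (ℕ × Fin n)) : Set _) T := by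
    rintro c' hc' ⟨l, m⟩ hq
    simp only [Finset.coe_product, mem_prod, Finset.mem_coe, Finset.mem_range] at hq
    by_cases hl : l < j
    · simpa [hT, hl] using (hS c' hc').1 (l, m) hl
    · obtain rfl : l = j := by omega
      simpa [hT] using (hS c' hc').2 m
  have hprod : ∏ l ∈ Finset.range j, cantorRatio n l =
      cantorScale n 0 / ((4 * n) ^ j * cantorScale n j) := by
    clear * - hn hn'
    induction j with
    | zero => simp [(cantorScale_pos hn 0).ne']
    | succ j ih =>
      have h1 := cantorScale_pos hn j
      have h2 := cantorScale_pos hn (j + 1)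
      rw [Finset.prod_range_succ, ih, cantorRatio, pow_succ]
      field_simp
  calc digitMeasure n α S ≤ digitMeasure n α _ := measure_mono hsub
    _ = ∏ q ∈ Finset.range (j + 1) ×ˢ Finset.univ, ProbabilityTheory.uniformOn univ (T q) :=
        Measure.infinitePi_pi _ fun _ _ => MeasurableSet.of_discrete
    _ = (∏ l ∈ Finset.range j, ∏ m, ProbabilityTheory.uniformOn univ (T (l, m))) *
          ∏ m, ProbabilityTheory.uniformOn univ (T (j, m)) := by
        rw [Finset.prod_product, Finset.prod_range_succ]
    _ ≤ (∏ l ∈ Finset.range j, ∏ m, ENNReal.ofReal (2 * ((cantorRatio n l)⁻¹) ^ α m)) *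
          ∏ m, ENNReal.ofReal (3 * (4 * ρ / cantorScale n j) ^ α m) := by
        refine mul_le_mul' (Finset.prod_le_prod' fun l hl => Finset.prod_le_prod' fun m _ => ?_)
          (Finset.prod_le_prod' fun m _ => ?_)
        · have hl' : l < j := Finset.mem_range.1 hl
          simp only [hT, hl', if_true]
          rw [uniformOn_univ_singleton]
          exact ENNReal.ofReal_le_ofReal (inv_digitCount_le hn h0 (l, m))
        · simp only [hT, lt_irrefl, if_false]
          exact uniformOn_univ_digit_le hn h0 h1 j m hρ _
    _ = ENNReal.ofReal ((∏ l ∈ Finset.range j, ∏ m, 2 * ((cantorRatio n l)⁻¹) ^ α m) *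
          ∏ m, 3 * (4 * ρ / cantorScale n j) ^ α m) := by
        have hN : ∀ l, 0 ≤ cantorRatio n l := fun l => zero_le_one.trans (one_le_cantorRatio hn l)
        have hpos : ∀ l m, 0 ≤ 2 * ((cantorRatio n l)⁻¹) ^ α m := fun l m => by
          have := hN l; positivity
        rw [ENNReal.ofReal_mul (Finset.prod_nonneg fun l _ => Finset.prod_nonneg fun m _ => hpos l m),
          ENNReal.ofReal_prod_of_nonneg (fun l _ => Finset.prod_nonneg fun m _ => hpos l m),
          ENNReal.ofReal_prod_of_nonneg (s := Finset.univ)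
            (f := fun m => 3 * (4 * ρ / cantorScale n j) ^ α m) (fun m _ => by positivity)]
        congr 1
        exact Finset.prod_congr rfl fun l _ =>
          (ENNReal.ofReal_prod_of_nonneg fun m _ => hpos l m).symm
    _ = ENNReal.ofReal (A ^ j * B * ρ ^ d) := by
        congr 1
        have hN : ∀ l, 0 < cantorRatio n l := fun l => zero_lt_one.trans_le (one_le_cantorRatio hn l)
        have e1 : ∀ l, ∏ m, 2 * ((cantorRatio n l)⁻¹) ^ α m = 2 ^ n * ((cantorRatio n l)⁻¹) ^ d := by
          intro l
          rw [Finset.prod_mul_distrib, ← Real.rpow_sum_of_pos (inv_pos.2 (hN l))]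
          simp [hd]
        have e2 : ∏ m, 3 * (4 * ρ / cantorScale n j) ^ α m =
            3 ^ n * (4 * ρ / cantorScale n j) ^ d := by
          rw [Finset.prod_mul_distrib, ← Real.rpow_sum_of_pos (by positivity)]
          simp [hd]
        rw [e2, Finset.prod_congr rfl fun l _ => e1 l, Finset.prod_mul_distrib,
          Real.finsetProd_rpow _ _ (fun l _ => (inv_pos.2 (hN l)).le), Finset.prod_inv_distrib, hprod,
          hA, hB, mul_pow ((2 : ℝ) ^ n), ← Real.rpow_natCast ((4 * n : ℝ) ^ d) j, ← Real.rpow_mul (by positivity),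
          mul_comm d (j : ℝ), Real.rpow_mul (by positivity), Real.rpow_natCast (4 * n : ℝ)]
        simp only [Finset.prod_const, Finset.card_range, inv_div]
        have e3 : ((4 * (n : ℝ)) ^ j * cantorScale n j / cantorScale n 0) ^ d *
            (4 * ρ / cantorScale n j) ^ d =
            ((4 * (n : ℝ)) ^ j) ^ d * (4 / cantorScale n 0) ^ d * ρ ^ d := by
          rw [← Real.mul_rpow (by positivity) (by positivity),
            ← Real.mul_rpow (by positivity) (by positivity),
            ← Real.mul_rpow (by positivity) (by positivity)]
          congr 1
          field_simp
        linear_combination (2 ^ n) ^ j * 3 ^ n * e3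
    _ ≤ _ := by
        refine ENNReal.ofReal_le_ofReal ?_
        gcongr
        rw [mul_pow A B]
        exact mul_le_mul (pow_le_pow_right₀ hA1 j.le_succ) (le_self_pow₀ hB1 j.succ_ne_zero)
          (by positivity) (by positivity)

end DigitMeasure

/-! ### The lower bound by mass distribution -/

section DigitLowerBound

variable {n : ℕ} {α : Fin n → ℝ}

/-- If sets of diameter comparable to the scales determine the digits up to the corresponding
precision, then the dimension of the range of `g` is at least the sum of the exponents. -/
lemma le_dimH_range_of_digits {Y : Type*} [MetricSpace Y] (hn : 0 < n) (h0 : ∀ m, 0 ≤ α m)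
    (h1 : ∀ m, α m ≤ 1) (g : DigitSpace n α → Y) (hg : Continuous g)
    (h : ∀ (j : ℕ) (ρ : ℝ) (c c' : DigitSpace n α), 2 * n * cantorScale n (j + 1) ≤ ρ →
      ρ < 2 * n * cantorScale n j → dist (g c') (g c) ≤ ρ →
      (∀ q, q.1 < j → c' q = c q) ∧ ∀ m, cantorScale n j *
        (|((c' (j, m) : ℕ) : ℝ) - (c (j, m) : ℕ)| / digitCount n α (j, m)) ≤ 2 * ρ) :
    ENNReal.ofReal (∑ m, α m) ≤ dimH (range g) := by
  borelize Y
  have hn' : (0 : ℝ) < n := by exact_mod_cast hn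
  set d := ∑ m, α m with hd
  have hd0 : 0 ≤ d := Finset.sum_nonneg fun m _ => h0 m
  have hne : ∀ q, NeZero (digitCount n α q) := fun q => ⟨(digitCount_pos hn h0 _).ne'⟩
  have hprob : IsProbabilityMeasure (digitMeasure n α) := by
    unfold digitMeasure; infer_instance
  obtain ⟨G, hG, hμ⟩ := digitMeasure_le hn h0 h1
  refine le_of_forall_lt fun t ht => ?_
  lift t to ℝ≥0 using ht.ne_top
  have htd : (t : ℝ) < d := by
    rw [← ENNReal.ofReal_coe_nnreal] at ht
    exact (ENNReal.ofReal_lt_ofReal_iff_of_nonneg t.2).1 ht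
  obtain ⟨s, hts, hsd⟩ := exists_between htd
  have hs0 : 0 < s := t.2.trans_lt hts
  suffices hsuff : ((s.toNNReal : ℝ≥0) : ℝ≥0∞) ≤ dimH (range g) by
    refine lt_of_lt_of_le ?_ hsuff
    rw [ENNReal.coe_lt_coe]
    exact (Real.lt_toNNReal_iff_coe_lt).2 hts
  refine le_dimH_of_hausdorffMeasure_ne_zero ?_
  rw [Real.coe_toNNReal s hs0.le]
  -- The spare power ρ^η absorbs the constants G^(j+1), since the scales decay faster than any
  -- geometric sequence.
  set η := d - s with hη
  have hη0 : 0 < η := sub_pos.2 hsd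
  have hlim : Tendsto (fun j => (2 * n : ℝ) ^ η * (G ^ (j + 1) * cantorScale n j ^ η)) atTop (𝓝 0) := by
    simpa using (tendsto_pow_mul_cantorScale_rpow hn hG hη0).const_mul ((2 * n : ℝ) ^ η)
  obtain ⟨J, hJ⟩ := eventually_atTop.1 (hlim.eventually (ge_mem_nhds one_pos))
  have hbound : ∀ (S : Set Y) (ρ : ℝ), 0 < ρ → ρ < 2 * n * cantorScale n J →
      (∀ x ∈ S, ∀ y ∈ S, dist x y ≤ ρ) → digitMeasure n α (g ⁻¹' S) ≤ ENNReal.ofReal (ρ ^ s) := by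
    intro S ρ hρ0 hρJ hS
    rcases (g ⁻¹' S).eq_empty_or_nonempty with hemp | ⟨c, hc⟩
    · simp [hemp]
    have hex : ∃ i, 2 * n * cantorScale n (i + 1) ≤ ρ := by
      have hl : Tendsto (fun i => 2 * n * cantorScale n (i + 1)) atTop (𝓝 0) := by
        simpa using ((tendsto_add_atTop_iff_nat 1).2 (tendsto_cantorScale hn)).const_mul (2 * n : ℝ)
      exact (hl.eventually (ge_mem_nhds hρ0)).exists
    classical
    -- This is the stage whose scales bracket the size: 2n δ_(j+1) ≤ ρ < 2n δ_j.
    set j := Nat.find hex with hj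
    have hj1 : 2 * n * cantorScale n (j + 1) ≤ ρ := Nat.find_spec hex
    have hJj : J ≤ j := by
      by_contra! hlt
      have := cantorScale_antitone hn hlt
      exact absurd hρJ (not_lt.2 (le_trans (by gcongr) hj1))
    have hj2 : ρ < 2 * n * cantorScale n j := by
      rcases Nat.eq_zero_or_pos j with h0 | hpos
      · rwa [show j = J by omega]
      · have hmin := Nat.find_min hex (m := j - 1) (by omega)
        rw [Nat.sub_add_cancel hpos] at hmin
        exact not_le.1 hmin
    refine (hμ j ρ hj1 c _ fun c' hc' => h j ρ c c' hj1 hj2 (hS _ hc' _ hc)).trans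
      (ENNReal.ofReal_le_ofReal ?_)
    have hδ := cantorScale_pos hn j
    calc G ^ (j + 1) * ρ ^ d = (G ^ (j + 1) * ρ ^ η) * ρ ^ s := by
          rw [mul_assoc, ← Real.rpow_add hρ0]; simp [hη]
      _ ≤ (G ^ (j + 1) * (2 * n * cantorScale n j) ^ η) * ρ ^ s := by gcongr
      _ = ((2 * n : ℝ) ^ η * (G ^ (j + 1) * cantorScale n j ^ η)) * ρ ^ s := by
          rw [Real.mul_rpow (by positivity) hδ.le]; ring
      _ ≤ 1 * ρ ^ s := by gcongr; exact hJ j hJj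
      _ = ρ ^ s := one_mul _
  have hδJ := cantorScale_pos hn J
  have hle : Measure.map g (digitMeasure n α) ≤ μH[s] := by
    refine Measure.le_hausdorffMeasure s _ (ENNReal.ofReal (n * cantorScale n J))
      (by rw [ENNReal.ofReal_pos]; positivity) fun S hS => ?_
    have hfin : Metric.ediam S ≠ ∞ := ne_top_of_le_ne_top ENNReal.ofReal_ne_top hS
    set D := (Metric.ediam S).toReal with hD
    have hDe : Metric.ediam S = ENNReal.ofReal D := (ENNReal.ofReal_toReal hfin).symm
    have hD0 : 0 ≤ D := ENNReal.toReal_nonneg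
    have hDJ : D < 2 * n * cantorScale n J := by
      rw [hDe, ENNReal.ofReal_le_ofReal_iff (by positivity)] at hS
      have : 0 < n * cantorScale n J := by positivity
      linarith
    have hdist : ∀ x ∈ closure S, ∀ y ∈ closure S, dist x y ≤ D := by
      intro x hx y hy
      have := Metric.edist_le_ediam_of_mem hx hy
      rwa [Metric.ediam_closure, hDe, edist_dist, ENNReal.ofReal_le_ofReal_iff hD0] at this
    -- The closure has the same diameter and a measurable preimage. Sizes ρ > D are used because D
    -- may be 0; then ρ tends to D.
    have hstep : ∀ᶠ ρ in 𝓝[>] D, Measure.map g (digitMeasure n α) S ≤ ENNReal.ofReal (ρ ^ s) := by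
      filter_upwards [self_mem_nhdsWithin, nhdsWithin_le_nhds (gt_mem_nhds hDJ)] with ρ hρ hρJ
      have hρ' : D < ρ := hρ
      calc Measure.map g (digitMeasure n α) S ≤ Measure.map g (digitMeasure n α) (closure S) :=
            measure_mono subset_closure
        _ = digitMeasure n α (g ⁻¹' closure S) :=
            Measure.map_apply hg.measurable isClosed_closure.measurableSet
        _ ≤ _ := hbound _ ρ (hD0.trans_lt hρ') hρJ fun x hx y hy => (hdist x hx y hy).trans hρ'.le
    have htend : Tendsto (fun ρ : ℝ => ENNReal.ofReal (ρ ^ s)) (𝓝[>] D) (𝓝 (ENNReal.ofReal (D ^ s))) :=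
      ENNReal.tendsto_ofReal
        ((Real.continuousAt_rpow_const _ _ (Or.inr hs0.le)).tendsto.mono_left nhdsWithin_le_nhds)
    rw [hDe, ENNReal.ofReal_rpow_of_nonneg hD0 hs0.le]
    exact ge_of_tendsto htend hstep
  have hpos : (1 : ℝ≥0∞) ≤ μH[s] (range g) := by
    calc (1 : ℝ≥0∞) = digitMeasure n α (g ⁻¹' range g) := by
          rw [preimage_range, measure_univ]
      _ ≤ Measure.map g (digitMeasure n α) (range g) :=
          Measure.le_map_apply hg.measurable.aemeasurable _
      _ ≤ _ := hle _
  exact (one_pos.trans_le hpos).ne'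

end DigitLowerBound

/-! ### Points with given digit expansions -/

section DigitSum

variable {n : ℕ} {α : Fin n → ℝ} {F : Type*} [NormedAddCommGroup F] [NormedSpace ℝ F]

/-- The contribution of the digits of stage `j`, with respect to the vectors `w j`. -/
noncomputable def digitTerm (w : ℕ → Fin n → F) (c : DigitSpace n α) (j : ℕ) : F :=
  ∑ m, (((c (j, m) : ℕ) : ℝ) / digitCount n α (j, m)) • w j m

/-- The point with digit expansion `c` with respect to the vectors `w`. -/
noncomputable def digitSum (w : ℕ → Fin n → F) (c : DigitSpace n α) : F :=
  ∑' j, cantorScale n j • digitTerm w c j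

lemma digit_div_mem_Icc (c : DigitSpace n α) (q : ℕ × Fin n) :
    ((c q : ℕ) : ℝ) / digitCount n α q ∈ Icc (0 : ℝ) 1 := by
  refine ⟨by positivity, div_le_one_of_le₀ ?_ (by positivity)⟩
  exact_mod_cast (c q).2.le

lemma norm_digitTerm_sub_le {w : ℕ → Fin n → F} {R : ℝ} (hw : ∀ j m, ‖w j m‖ ≤ R)
    (c c' : DigitSpace n α) (j : ℕ) : ‖digitTerm w c j - digitTerm w c' j‖ ≤ n * R := by
  rw [digitTerm, digitTerm, ← Finset.sum_sub_distrib]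
  refine (norm_sum_le _ _).trans ?_
  calc _ ≤ ∑ _m : Fin n, R := by
        refine Finset.sum_le_sum fun m _ => ?_
        rw [← sub_smul, norm_smul, Real.norm_eq_abs]
        have h1 := digit_div_mem_Icc c (j, m)
        have h2 := digit_div_mem_Icc c' (j, m)
        have h3 : |((c (j, m) : ℕ) : ℝ) / digitCount n α (j, m) -
            ((c' (j, m) : ℕ) : ℝ) / digitCount n α (j, m)| ≤ 1 := by
          rw [abs_le]; constructor <;> linarith [h1.1, h1.2, h2.1, h2.2]
        exact (mul_le_of_le_one_left (norm_nonneg _) h3).trans (hw j m)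
    _ = _ := by simp

lemma norm_digitTerm_le {w : ℕ → Fin n → F} {R : ℝ} (hw : ∀ j m, ‖w j m‖ ≤ R)
    (c : DigitSpace n α) (j : ℕ) : ‖digitTerm w c j‖ ≤ n * R := by
  rw [digitTerm]
  refine (norm_sum_le _ _).trans ?_
  calc _ ≤ ∑ _m : Fin n, R := by
        refine Finset.sum_le_sum fun m _ => ?_
        rw [norm_smul, Real.norm_eq_abs]
        have h1 := digit_div_mem_Icc c (j, m)
        rw [abs_of_nonneg h1.1]
        exact (mul_le_of_le_one_left (norm_nonneg _) h1.2).trans (hw j m)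
    _ = _ := by simp

lemma norm_smul_digitTerm_le {w : ℕ → Fin n → F} {R : ℝ} (hn : 0 < n) (hw : ∀ j m, ‖w j m‖ ≤ R)
    (c : DigitSpace n α) (j : ℕ) :
    ‖cantorScale n j • digitTerm w c j‖ ≤ cantorScale n 0 * (1 / 2) ^ j * (n * R) := by
  have hδ := cantorScale_pos hn j
  rw [norm_smul, Real.norm_eq_abs, abs_of_pos hδ]
  have h1 := cantorScale_add_le hn 0 j
  have h2 := norm_digitTerm_le hw c j
  exact mul_le_mul h1 h2 (norm_nonneg _) (hδ.le.trans h1)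

lemma summable_geometric_bound (a b : ℝ) : Summable fun j : ℕ => a * (1 / 2 : ℝ) ^ j * b :=
  (summable_geometric_two.mul_left a).mul_right b

lemma summable_digitSum [CompleteSpace F] {w : ℕ → Fin n → F} {R : ℝ} (hn : 0 < n)
    (hw : ∀ j m, ‖w j m‖ ≤ R) (c : DigitSpace n α) :
    Summable fun j => cantorScale n j • digitTerm w c j :=
  Summable.of_norm_bounded (summable_geometric_bound _ _) fun j => norm_smul_digitTerm_le hn hw c j

lemma continuous_digitSum [CompleteSpace F] {w : ℕ → Fin n → F} {R : ℝ} (hn : 0 < n)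
    (hw : ∀ j m, ‖w j m‖ ≤ R) : Continuous (digitSum w : DigitSpace n α → F) := by
  refine continuous_tsum (fun j => ?_) (summable_geometric_bound _ _)
    fun j c => norm_smul_digitTerm_le hn hw c j
  refine continuous_const.smul (continuous_finsetSum _ fun m _ => Continuous.smul ?_ continuous_const)
  exact (continuous_of_discreteTopology (f := fun a : Fin (digitCount n α (j, m)) =>
    ((a : ℕ) : ℝ) / digitCount n α (j, m))).comp (continuous_apply (j, m))

/-- The digits of stages from `j` on contribute at most a constant times the scale of stage `j`. -/
lemma norm_digitSum_sub_sub_sum_le [CompleteSpace F] {w : ℕ → Fin n → F} {R : ℝ} (hn : 0 < n)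
    (hw : ∀ j m, ‖w j m‖ ≤ R) (c c' : DigitSpace n α) (j : ℕ) :
    ‖digitSum w c - digitSum w c' -
      ∑ l ∈ Finset.range j, cantorScale n l • (digitTerm w c l - digitTerm w c' l)‖ ≤
      2 * n * R * cantorScale n j := by
  have hs := (summable_digitSum hn hw c).sub (summable_digitSum hn hw c')
  simp only [← smul_sub] at hs
  have h1 : digitSum w c - digitSum w c' -
      ∑ l ∈ Finset.range j, cantorScale n l • (digitTerm w c l - digitTerm w c' l) =
      ∑' i, cantorScale n (i + j) • (digitTerm w c (i + j) - digitTerm w c' (i + j)) := by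
    rw [digitSum, digitSum, ← (summable_digitSum hn hw c).tsum_sub (summable_digitSum hn hw c')]
    simp only [← smul_sub]
    rw [← hs.sum_add_tsum_nat_add j, add_sub_cancel_left]
  rw [h1]
  have hsum : HasSum (fun i : ℕ => cantorScale n j * (1 / 2 : ℝ) ^ i * (n * R))
      (2 * n * R * cantorScale n j) := by
    have := (hasSum_geometric_two.mul_left (cantorScale n j)).mul_right (n * R)
    rwa [show cantorScale n j * 2 * (n * R) = 2 * n * R * cantorScale n j by ring] at this
  refine tsum_of_norm_bounded hsum fun i => ?_
  have hδ := cantorScale_pos hn (i + j)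
  rw [norm_smul, Real.norm_eq_abs, abs_of_pos hδ]
  exact mul_le_mul (cantorScale_add_le hn j i) (norm_digitTerm_sub_le hw c c' _) (norm_nonneg _)
    (hδ.le.trans (cantorScale_add_le hn j i))

/-- A linear map thus acts stage by stage, so the vectors in its kernel simply drop out of the
expansion. -/
lemma map_digitSum [CompleteSpace F] {F' : Type*} [NormedAddCommGroup F'] [NormedSpace ℝ F']
    {w : ℕ → Fin n → F} {R : ℝ} (hn : 0 < n) (hw : ∀ j m, ‖w j m‖ ≤ R) (L : F →L[ℝ] F')
    (c : DigitSpace n α) : L (digitSum w c) = digitSum (fun j m => L (w j m)) c := by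
  rw [digitSum, L.map_tsum (summable_digitSum hn hw c), digitSum]
  simp [digitTerm, map_sum]

/-- If the first `p` vectors vanish at infinitely many stages, the dimension of the set of digit sums
is bounded by the sum of the other exponents. -/
lemma dimH_range_digitSum_le [CompleteSpace F] {w : ℕ → Fin n → F} {R : ℝ} (hn : 0 < n)
    (h0 : ∀ m, 0 ≤ α m) (h1 : ∀ m, α m ≤ 1) (hw : ∀ j m, ‖w j m‖ ≤ R) (p : ℕ)
    (hp : ∃ᶠ j in atTop, ∀ m : Fin n, m.val < p → w j m = 0) :
    dimH (range (digitSum w : DigitSpace n α → F)) ≤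
      ENNReal.ofReal (∑ m with p ≤ (m : Fin n).val, α m) := by
  refine dimH_range_le_of_digits hn h0 h1 p _ (2 * n * R) (hp.mono fun j hj c c' hlt hm => ?_)
  have h := norm_digitSum_sub_sub_sum_le hn hw c c' (j + 1)
  rwa [Finset.sum_eq_zero, sub_zero, ← dist_eq_norm] at h
  intro l hl
  have heq : digitTerm w c l = digitTerm w c' l := by
    refine Finset.sum_congr rfl fun m _ => ?_
    rcases (Nat.lt_succ_iff.1 (Finset.mem_range.1 hl)).lt_or_eq with hlj | rfl
    · rw [hlt (l, m) hlj]
    · rcases lt_or_ge m.val p with hmp | hmp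
      · rw [hj m hmp, smul_zero, smul_zero]
      · rw [hm m hmp]
  rw [heq, sub_self, smul_zero]

end DigitSum

/-! ### Expansions in orthonormal bases -/

section OrthonormalDigits

variable {n : ℕ} {α : Fin n → ℝ} {E : Type*} [NormedAddCommGroup E] [InnerProductSpace ℝ E]
  [CompleteSpace E]

/-- When all earlier digits agree, the difference of the sums is its stage-j part up to a tail of
size 2n δ_(j+1). Pairing the stage-j part with a unit basis vector reads off a single digit. -/
lemma abs_digit_sub_le (hn : 0 < n) (b : ℕ → OrthonormalBasis (Fin n) ℝ E)
    (c c' : DigitSpace n α) (j : ℕ) (h : ∀ q, q.1 < j → c' q = c q) (m : Fin n) :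
    cantorScale n j * (|((c' (j, m) : ℕ) : ℝ) - (c (j, m) : ℕ)| / digitCount n α (j, m)) ≤
      dist (digitSum (fun j m => b j m) c') (digitSum (fun j m => b j m) c) +
        2 * n * cantorScale n (j + 1) := by
  set w : ℕ → Fin n → E := fun j m => b j m with hw'
  have hw : ∀ j m, ‖w j m‖ ≤ 1 := fun j m => ((b j).orthonormal.1 m).le
  have hδ := cantorScale_pos hn j
  have h1 := norm_digitSum_sub_sub_sum_le hn hw c' c (j + 1)
  rw [Finset.sum_range_succ, Finset.sum_eq_zero, zero_add, mul_one] at h1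
  · have h2 : inner ℝ (b j m) (cantorScale n j • (digitTerm w c' j - digitTerm w c j)) =
        cantorScale n j * ((((c' (j, m) : ℕ) : ℝ) - (c (j, m) : ℕ)) / digitCount n α (j, m)) := by
      rw [inner_smul_right, inner_sub_right, digitTerm, digitTerm,
        (b j).orthonormal.inner_right_fintype, (b j).orthonormal.inner_right_fintype, sub_div]
    have h3 : cantorScale n j * (|((c' (j, m) : ℕ) : ℝ) - (c (j, m) : ℕ)| / digitCount n α (j, m)) ≤
        ‖cantorScale n j • (digitTerm w c' j - digitTerm w c j)‖ := by
      calc _ = |inner ℝ (b j m) (cantorScale n j • (digitTerm w c' j - digitTerm w c j))| := by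
            rw [h2, abs_mul, abs_of_pos hδ, abs_div, abs_of_nonneg
              (by positivity : (0 : ℝ) ≤ digitCount n α (j, m))]
        _ ≤ ‖b j m‖ * _ := abs_real_inner_le_norm _ _
        _ = _ := by rw [(b j).orthonormal.1 m, one_mul]
    rw [dist_eq_norm]
    set x := digitSum w c' - digitSum w c
    set y := cantorScale n j • (digitTerm w c' j - digitTerm w c j)
    have h4 : ‖y‖ ≤ ‖x‖ + ‖x - y‖ := by
      calc ‖y‖ = ‖x - (x - y)‖ := by rw [sub_sub_cancel]
        _ ≤ _ := norm_sub_le _ _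
    linarith
  · intro l hl
    have : digitTerm w c' l = digitTerm w c l :=
      Finset.sum_congr rfl fun m _ => by rw [h (l, m) (Finset.mem_range.1 hl)]
    rw [this, sub_self, smul_zero]

/-- Digit sums with respect to orthonormal bases fill a set of dimension at least the sum of the
exponents. -/
lemma le_dimH_range_digitSum (hn : 0 < n) (h0 : ∀ m, 0 ≤ α m) (h1 : ∀ m, α m ≤ 1)
    (b : ℕ → OrthonormalBasis (Fin n) ℝ E) :
    ENNReal.ofReal (∑ m, α m) ≤
      dimH (range (digitSum (fun j m => b j m) : DigitSpace n α → E)) := by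
  refine le_dimH_range_of_digits hn h0 h1 _ (continuous_digitSum (R := 1) hn
    fun j m => ((b j).orthonormal.1 m).le) fun j ρ c c' hρ hρ' hd => ?_
  have hagree : ∀ l ≤ j, ∀ q : ℕ × Fin n, q.1 < l → c' q = c q := by
    intro l
    induction l with
    | zero => intro _ q hq; exact absurd hq (Nat.not_lt_zero _)
    | succ l ih =>
      rintro hl ⟨l', m⟩ hq
      have ihl := ih (by omega)
      rcases (Nat.lt_succ_iff.1 hq).lt_or_eq with hlt | heq
      · exact ihl _ hlt
      · obtain rfl : l' = l := heq
        by_contra hne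
        have h2 := abs_digit_sub_le hn b c c' l' ihl m
        have hδ := cantorScale_pos hn l'
        have hδ' := cantorScale_pos hn (l' + 1)
        have hn' : (0 : ℝ) < n := by exact_mod_cast hn
        have hM : (0 : ℝ) < digitCount n α (l', m) := by exact_mod_cast digitCount_pos hn h0 _
        have h3 : (1 : ℝ) ≤ |((c' (l', m) : ℕ) : ℝ) - (c (l', m) : ℕ)| := by
          have hne' : ((c' (l', m) : ℕ) : ℤ) - (c (l', m) : ℕ) ≠ 0 := by
            intro h
            exact hne (Fin.ext (by omega))
          exact_mod_cast Int.one_le_abs hne'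
        have h4 : 4 * n * cantorScale n (l' + 1) ≤
            cantorScale n l' * (|((c' (l', m) : ℕ) : ℝ) - (c (l', m) : ℕ)| /
              digitCount n α (l', m)) := by
          rw [← mul_div_assoc, le_div_iff₀ hM]
          calc 4 * n * cantorScale n (l' + 1) * digitCount n α (l', m)
              ≤ 4 * n * cantorScale n (l' + 1) * cantorRatio n l' := by
                gcongr; exact digitCount_le_ratio hn h1 (l', m)
            _ = cantorScale n l' * 1 := by rw [cantorRatio]; field_simp
            _ ≤ _ := by gcongr
        -- A differing digit at an earlier stage l' would force 4n δ_(l'+1) ≤ ρ + 2n δ_(l'+1),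
        -- whereas ρ < 2n δ_j ≤ 2n δ_(l'+1).
        have h5 : 2 * n * cantorScale n j ≤ 2 * n * cantorScale n (l' + 1) := by
          have := cantorScale_antitone hn hl
          gcongr
        linarith
  refine ⟨hagree j le_rfl, fun m => ?_⟩
  have := abs_digit_sub_le hn b c c' j (hagree j le_rfl) m
  linarith

end OrthonormalDigits

/-! ### The compact set of centers and radii -/

section Code

/-- An orthonormal basis whose first vectors span a given subspace. -/
lemma exists_orthonormalBasis_mem_submodule {n p : ℕ}
    (W : Submodule ℝ (EuclideanSpace ℝ (Fin n))) (hW : Module.finrank ℝ W = p) :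
    ∃ b : OrthonormalBasis (Fin n) ℝ (EuclideanSpace ℝ (Fin n)),
      ∀ m : Fin n, m.val < p → b m ∈ W := by
  set a := stdOrthonormalBasis ℝ W
  set v : Fin n → EuclideanSpace ℝ (Fin n) := fun m =>
    if h : m.val < Module.finrank ℝ W then (a ⟨m, h⟩ : EuclideanSpace ℝ (Fin n)) else 0 with hv
  have hcard : Module.finrank ℝ (EuclideanSpace ℝ (Fin n)) = Fintype.card (Fin n) := by simp
  have horth : Orthonormal ℝ (({m : Fin n | m.val < p} : Set (Fin n)).domRestrict v) := by
    have ha : Orthonormal ℝ fun i => (a i : EuclideanSpace ℝ (Fin n)) :=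
      a.orthonormal.comp_linearIsometry W.subtypeₗᵢ
    have hinj : Function.Injective fun m : ({m : Fin n | m.val < p} : Set (Fin n)) =>
        (⟨m.1.val, hW.symm ▸ m.2⟩ : Fin (Module.finrank ℝ W)) := by
      intro m m' h
      simpa [Fin.ext_iff, Subtype.ext_iff] using h
    convert ha.comp _ hinj using 1
    ext1 ⟨m, hm⟩
    have hm' : m.val < Module.finrank ℝ W := hW.symm ▸ hm
    simp [hv, Set.domRestrict, hm']
  obtain ⟨b, hb⟩ := horth.exists_orthonormalBasis_extension_of_card_eq hcard
  refine ⟨b, fun m hm => ?_⟩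
  have hm' : m.val < Module.finrank ℝ W := hW.symm ▸ hm
  rw [hb m hm]
  simp [hv, hm']

/-- A sequence visiting every element of a countable type infinitely often. -/
lemma exists_seq_frequently_eq (ι : Type*) [Countable ι] [Nonempty ι] :
    ∃ f : ℕ → ι, ∀ i, ∃ᶠ j in atTop, f j = i := by
  obtain ⟨g, hg⟩ := exists_surjective_nat (ι × ℕ)
  refine ⟨fun j => (g j).1, fun i => ?_⟩
  rw [Nat.frequently_atTop_iff_infinite]
  refine Set.Infinite.of_image g (Set.Infinite.mono ?_
    (Set.infinite_range_of_injective (Prod.mk_right_injective i)))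
  rintro _ ⟨k, rfl⟩
  obtain ⟨j, hj⟩ := hg (i, k)
  exact ⟨j, by simp [hj], hj⟩

/-- The exponents of the coordinate directions: as many ones as possible, then the rest. -/
noncomputable def coordExponent (n : ℕ) (d : ℝ) (m : Fin n) : ℝ :=
  min d ((m.val : ℝ) + 1) - min d m.val

lemma coordExponent_nonneg {n : ℕ} (d : ℝ) (m : Fin n) : 0 ≤ coordExponent n d m :=
  sub_nonneg.2 (min_le_min_left _ (by linarith))

lemma coordExponent_le_one {n : ℕ} (d : ℝ) (m : Fin n) : coordExponent n d m ≤ 1 := by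
  unfold coordExponent
  rcases min_cases d (m.val : ℝ) with h | h <;> rw [h.1]
  · linarith [min_le_left d ((m.val : ℝ) + 1)]
  · linarith [min_le_right d ((m.val : ℝ) + 1)]

/-- The sum telescopes. Filling the directions in order makes the first p carry weight min(d, p),
the most that exponents in [0, 1] with sum d allow. -/
lemma sum_coordExponent {n p : ℕ} (hp : p ≤ n) {d : ℝ} (hd : d ≤ n) :
    ∑ m with p ≤ (m : Fin n).val, coordExponent n d m = d - min d p := by
  have key : ∀ N, p ≤ N → ∑ i ∈ Finset.range N,
      (if p ≤ i then min d ((i : ℝ) + 1) - min d i else 0) = min d N - min d p := by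
    intro N hN
    induction N, hN using Nat.le_induction with
    | base =>
      rw [sub_self]
      exact Finset.sum_eq_zero fun i hi => if_neg (by simpa using hi)
    | succ N hN ih =>
      rw [Finset.sum_range_succ, ih, if_pos hN]
      push_cast; ring
  rw [Finset.sum_filter]
  have := key n hp
  rw [min_eq_left hd] at this
  rw [← this, ← Fin.sum_univ_eq_sum_range
    (fun i => if p ≤ i then min d ((i : ℝ) + 1) - min d i else 0)]
  rfl

/-- For finitely many `p`-dimensional graphs over subspaces `W i`, there is a compact set of
pairs whose first components form a set of dimension `d`, while linear maps vanishing on one of the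
graphs reduce its dimension to at most `max (d - p) 0`. -/
theorem exists_isCompact_dimH_fst_eq {n p : ℕ} (hn : 0 < n) {d : ℝ} (hd : d ∈ Icc (0 : ℝ) n)
    (hp : p ≤ n) {ι : Type*} [Finite ι] [Nonempty ι]
    (W : ι → Submodule ℝ (EuclideanSpace ℝ (Fin n))) (hW : ∀ i, Module.finrank ℝ (W i) = p)
    (φ : ι → EuclideanSpace ℝ (Fin n) →L[ℝ] ℝ) :
    ∃ K : Set (EuclideanSpace ℝ (Fin n) × ℝ), IsCompact K ∧ K.Nonempty ∧ (∀ z ∈ K, 0 < z.2) ∧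
      dimH (Prod.fst '' K) = ENNReal.ofReal d ∧
      ∀ i, ∀ L : EuclideanSpace ℝ (Fin n) × ℝ →L[ℝ] EuclideanSpace ℝ (Fin n),
        (∀ w ∈ W i, L (w, φ i w) = 0) → dimH (L '' K) ≤ ENNReal.ofReal (d - p) := by
  choose b hb using fun i => exists_orthonormalBasis_mem_submodule (W i) (hW i)
  obtain ⟨idx, hidx⟩ := exists_seq_frequently_eq ι
  set α := coordExponent n d with hα
  have h0 : ∀ m, 0 ≤ α m := coordExponent_nonneg d
  have h1 : ∀ m, α m ≤ 1 := coordExponent_le_one d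
  have hsum : ∑ m, α m = d := by
    have := sum_coordExponent (Nat.zero_le n) hd.2
    simpa [hd.1] using this
  -- Moving a center along a basis vector changes the radius by φ, so at stages assigned to i the
  -- first p vectors lie on the graph of φ i over W i.
  set w : ℕ → Fin n → EuclideanSpace ℝ (Fin n) × ℝ := fun j m =>
    (b (idx j) m, φ (idx j) (b (idx j) m)) with hw
  obtain ⟨R, hR⟩ := Finite.exists_le fun q : ι × Fin n => ‖(b q.1 q.2, φ q.1 (b q.1 q.2))‖
  have hwR : ∀ j m, ‖w j m‖ ≤ R := fun j m => hR (idx j, m)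
  have hne : ∀ q, NeZero (digitCount n α q) := fun q => ⟨(digitCount_pos hn h0 _).ne'⟩
  -- This exceeds the norm of every digit sum by 1; adding it to the second coordinate makes all
  -- radii positive.
  set s : ℝ := cantorScale n 0 * 2 * (n * R) + 1 with hs
  set e : DigitSpace n α → EuclideanSpace ℝ (Fin n) × ℝ := fun c => digitSum w c + (0, s) with he
  have hec : Continuous e := (continuous_digitSum hn hwR).add continuous_const
  have hnorm : ∀ c : DigitSpace n α, ‖digitSum w c‖ ≤ cantorScale n 0 * 2 * (n * R) := fun c =>
    tsum_of_norm_bounded ((hasSum_geometric_two.mul_left (cantorScale n 0)).mul_right (n * R))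
      fun j => norm_smul_digitTerm_le hn hwR c j
  have hLK : ∀ (L : EuclideanSpace ℝ (Fin n) × ℝ →L[ℝ] EuclideanSpace ℝ (Fin n)),
      dimH (L '' range e) =
        dimH (range (digitSum (fun j m => L (w j m)) : DigitSpace n α → _)) := by
    intro L
    rw [← (IsometryEquiv.addRight (L (0, s))).dimH_image (range (digitSum (fun j m => L (w j m)))),
      ← range_comp, ← range_comp]
    congr 2
    ext1 c
    simp only [he, Function.comp_apply, IsometryEquiv.addRight_apply, map_add]
    rw [map_digitSum hn hwR]
  refine ⟨range e, isCompact_range hec, range_nonempty _, ?_, ?_, ?_⟩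
  · rintro _ ⟨c, rfl⟩
    have h2 : |(digitSum w c).2| ≤ cantorScale n 0 * 2 * (n * R) :=
      (norm_snd_le (digitSum w c)).trans (hnorm c)
    have h3 := neg_le_of_abs_le h2
    simp only [he, Prod.snd_add, hs]
    linarith
  · have hfst := hLK (ContinuousLinearMap.fst ℝ _ _)
    simp only [ContinuousLinearMap.coe_fst', hw] at hfst
    rw [hfst]
    refine le_antisymm ?_ ?_
    · refine (dimH_range_digitSum_le (R := 1) hn h0 h1 (fun j m => ((b _).orthonormal.1 m).le) 0
        (Frequently.of_forall fun j m hm => absurd hm (Nat.not_lt_zero _))).trans ?_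
      simp [hsum]
    · rw [← hsum]
      exact le_dimH_range_digitSum hn h0 h1 fun j => b (idx j)
  · intro i L hL
    rw [hLK]
    refine (dimH_range_digitSum_le (R := ‖L‖ * R) hn h0 h1
      (fun j m => L.le_opNorm_of_le (hwR j m)) p ((hidx i).mono fun j hj m hm => ?_)).trans ?_
    · simp only [hw, hj]
      exact hL _ (hb i m hm)
    · rw [hα, sum_coordExponent hp hd.2]
      rcases min_cases d (p : ℝ) with h | h <;> rw [h.1]
      simp

end Code

/-! ### Faces and scaled copies -/

section Faces

variable {n k : ℕ} {P F : Set (EuclideanSpace ℝ (Fin n))}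

lemma IsPolytope.isCompact (hP : IsPolytope P) : IsCompact P := by
  obtain ⟨s, rfl⟩ := hP
  exact s.finite_toSet.isCompact_convexHull ℝ

lemma IsPolytope.convex (hP : IsPolytope P) : Convex ℝ P := by
  obtain ⟨s, rfl⟩ := hP
  exact convex_convexHull ℝ _

lemma IsKFace.isCompact (hF : IsKFace k P F) (hP : IsPolytope P) : IsCompact F :=
  hF.2.1.isCompact hP.isCompact

lemma IsKFace.convex (hF : IsKFace k P F) (hP : IsPolytope P) : Convex ℝ F :=
  hF.2.1.convex hP.convex

/-- A face is determined by its extreme points, which are vertices of the polytope. -/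
lemma IsPolytope.finite_setOf_isKFace (hP : IsPolytope P) (k : ℕ) :
    {F | IsKFace k P F}.Finite := by
  obtain ⟨s, hs⟩ := id hP
  refine Set.Finite.of_finite_image (f := fun F => F.extremePoints ℝ)
    (s.finite_toSet.finite_subsets.subset ?_) ?_
  · rintro _ ⟨F, hF, rfl⟩
    refine (hF.2.1.isExtreme.extremePoints_subset_extremePoints).trans ?_
    rw [hs]
    exact extremePoints_convexHull_subset
  · intro F hF G hG hFG
    rw [← closure_convexHull_extremePoints (IsKFace.isCompact hF hP) (IsKFace.convex hF hP),
      ← closure_convexHull_extremePoints (IsKFace.isCompact hG hP) (IsKFace.convex hG hP)]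
    exact congrArg (fun T => closure (convexHull ℝ T)) hFG

lemma kSkeleton_eq_biUnion : kSkeleton k P = ⋃ F ∈ {F | IsKFace k P F}, F := by
  ext x
  simp [kSkeleton]

lemma IsPolytope.isCompact_kSkeleton (hP : IsPolytope P) : IsCompact (kSkeleton k P) := by
  rw [kSkeleton_eq_biUnion]
  exact (hP.finite_setOf_isKFace k).isCompact_biUnion fun F hF => IsKFace.isCompact hF hP

/-- A nonempty convex set contains a ball of its direction around one of its points. -/
lemma Convex.exists_ball_vectorSpan_subset (hF : Convex ℝ F) (hne : F.Nonempty) :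
    ∃ y ∈ F, ∃ ε : ℝ, 0 < ε ∧ ∀ u ∈ vectorSpan ℝ F, ‖u‖ < ε → y + u ∈ F := by
  obtain ⟨y, hy⟩ := hne.intrinsicInterior hF
  have hyF := intrinsicInterior_subset hy
  obtain ⟨y', hy', rfl⟩ := mem_intrinsicInterior.1 hy
  obtain ⟨ε, hε, hball⟩ := Metric.mem_nhds_iff.1 (mem_interior_iff_mem_nhds.1 hy')
  refine ⟨_, hyF, ε, hε, fun u hu hun => ?_⟩
  have hmem : (y' : EuclideanSpace ℝ (Fin n)) + u ∈ affineSpan ℝ F := by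
    rw [add_comm, ← vadd_eq_add]
    exact AffineSubspace.vadd_mem_of_mem_direction (by rwa [direction_affineSpan]) y'.2
  have := hball (show (⟨_, hmem⟩ : affineSpan ℝ F) ∈ Metric.ball y' ε by
    rw [Metric.mem_ball, Subtype.dist_eq]; simpa using hun)
  exact this

lemma starProjection_orthogonal_eq_of_mem {s y : EuclideanSpace ℝ (Fin n)} (hs : s ∈ F)
    (hy : y ∈ F) :
    (vectorSpan ℝ F)ᗮ.starProjection s = (vectorSpan ℝ F)ᗮ.starProjection y := by
  rw [← sub_eq_zero, ← map_sub]
  exact Submodule.starProjection_orthogonal_apply_eq_zero (vsub_mem_vectorSpan ℝ hs hy)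

/-- This separates the two cases of the theorem: changing the radius moves the translate of V that
carries the copy of F exactly when 0 is outside the affine span. -/
lemma starProjection_orthogonal_eq_zero_iff {y : EuclideanSpace ℝ (Fin n)} (hy : y ∈ F) :
    (vectorSpan ℝ F)ᗮ.starProjection y = 0 ↔ (0 : EuclideanSpace ℝ (Fin n)) ∈ affineSpan ℝ F := by
  rw [Submodule.starProjection_apply_eq_zero_iff, Submodule.orthogonal_orthogonal,
    ← direction_affineSpan, ← neg_mem_iff, ← zero_sub, ← vsub_eq_sub,
    AffineSubspace.vsub_right_mem_direction_iff_mem (mem_affineSpan ℝ hy)]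

/-- A set with scaled copies of a `k`-skeleton has dimension at least `k`, and the set of centers is
at most `dim W - k` dimensions larger, if `W` contains some `k`-face. -/
lemma IsKFace.dimH_le (hP : IsPolytope P) (hF : IsKFace k P F)
    {A C : Set (EuclideanSpace ℝ (Fin n))} (hC : C.Nonempty)
    (hA : ContainsScaledCopies (kSkeleton k P) C A)
    (W : Submodule ℝ (EuclideanSpace ℝ (Fin n))) (hVW : vectorSpan ℝ F ≤ W) (hFW : F ⊆ W) :
    (k : ℝ≥0∞) ≤ dimH A ∧ dimH C + k ≤ dimH A + Module.finrank ℝ W := by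
  obtain ⟨y, hy, ε, hε, hball⟩ := (hF.convex hP).exists_ball_vectorSpan_subset hF.1
  set V := vectorSpan ℝ F with hV
  set D : Set (EuclideanSpace ℝ (Fin n)) := {z | z ∈ Vᗮ ∧ ∃ v : V, ∃ r : ℝ, 0 < r ∧
    ∀ u : V, dist u v < r → z + (u : EuclideanSpace ℝ (Fin n)) ∈ A} with hD
  -- The copy contains a ball of radius rε of V about x + r y. The Vᗮ-component of that point lies
  -- in D and differs from x by an element of W.
  have hCD : C ⊆ D + (W : Set (EuclideanSpace ℝ (Fin n))) := by
    intro x hx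
    obtain ⟨r, hr, hrA⟩ := hA x hx
    have hdec := V.starProjection_add_starProjection_orthogonal (x + r • y)
    refine ⟨Vᗮ.starProjection (x + r • y), ⟨Submodule.starProjection_apply_mem _ _,
      ⟨V.starProjection (x + r • y), Submodule.starProjection_apply_mem _ _⟩, r * ε,
      by positivity, fun u hu => ?_⟩, V.starProjection (x + r • y) - r • y,
      W.sub_mem (hVW (Submodule.starProjection_apply_mem _ _)) (W.smul_mem _ (hFW hy)), ?_⟩
    · set v : V := ⟨V.starProjection (x + r • y), Submodule.starProjection_apply_mem _ _⟩ with hv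
      refine hrA ⟨y + (r⁻¹ • (u - v) : V), ⟨F, hF, hball _ (Subtype.mem _) ?_⟩, ?_⟩
      · rw [← Submodule.coe_norm, norm_smul, norm_inv, Real.norm_eq_abs, abs_of_pos hr,
          inv_mul_lt_iff₀ hr, ← dist_eq_norm]
        exact hu
      · simp only [Submodule.coe_smul, Submodule.coe_sub, smul_add, smul_smul,
          mul_inv_cancel₀ hr.ne', one_smul]
        rw [← add_assoc]
        nth_rewrite 1 [← hdec]
        simp only [hv]
        abel
    · simp only
      nth_rewrite 3 [← add_sub_cancel_right x (r • y)]
      nth_rewrite 3 [← hdec]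
      abel
  have hDne : D.Nonempty := by
    obtain ⟨x, hx⟩ := hC
    obtain ⟨z, hz, -⟩ := hCD hx
    exact ⟨z, hz⟩
  have h1 := dimH_add_finrank_le_of_ball_subset V hDne fun z hz => hz
  rw [hF.2.2] at h1
  refine ⟨le_add_self.trans h1, ?_⟩
  calc dimH C + k ≤ dimH D + Module.finrank ℝ W + k := by
        gcongr
        exact (dimH_mono hCD).trans (dimH_add_submodule_le D W)
    _ = dimH D + k + Module.finrank ℝ W := by ring
    _ ≤ _ := by gcongr

/-- If for each face `F` there is a graph over a `p`-dimensional subspace that is collapsed by the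
map sending a center and a radius to the position of the scaled copy of `F` modulo its direction, then
there are small unions of scaled copies. -/
lemma IsPolytope.exists_mem_possibleDims_le {p : ℕ} (hn : 0 < n) (hP : IsPolytope P)
    (hS : (kSkeleton k P).Nonempty) {d : ℝ} (hd : d ∈ Icc (0 : ℝ) n) (hp : p ≤ n)
    (h : ∀ F, IsKFace k P F → ∃ (W : Submodule ℝ (EuclideanSpace ℝ (Fin n)))
      (φ : EuclideanSpace ℝ (Fin n) →L[ℝ] ℝ), Module.finrank ℝ W = p ∧ ∀ w ∈ W, ∀ s ∈ F,
        (vectorSpan ℝ F)ᗮ.starProjection w + φ w • (vectorSpan ℝ F)ᗮ.starProjection s = 0) :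
    ∃ a ∈ possibleDims (kSkeleton k P) d, a ≤ ENNReal.ofReal (d - p) + k := by
  have hfin : Finite {F // IsKFace k P F} := (hP.finite_setOf_isKFace k).to_subtype
  have hne : Nonempty {F // IsKFace k P F} := by
    obtain ⟨_, F, hF, -⟩ := hS
    exact ⟨⟨F, hF⟩⟩
  choose W φ hW hφ using fun F : {F // IsKFace k P F} => h F.1 F.2
  obtain ⟨K, hK, hKne, hKpos, hKdim, hKL⟩ := exists_isCompact_dimH_fst_eq hn hd hp W hW φ
  set f : (EuclideanSpace ℝ (Fin n) × ℝ) × EuclideanSpace ℝ (Fin n) → EuclideanSpace ℝ (Fin n) :=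
    fun z => z.1.1 + z.1.2 • z.2 with hf
  have hfc : Continuous f := by fun_prop
  set A := f '' (K ×ˢ kSkeleton k P) with hA
  refine ⟨dimH A, ⟨A, Prod.fst '' K, (hK.prod hP.isCompact_kSkeleton).image hfc,
    hK.image continuous_fst, hKne.image _, hKdim, ?_, rfl⟩, ?_⟩
  · rintro _ ⟨z, hz, rfl⟩
    refine ⟨z.2, hKpos z hz, ?_⟩
    rintro _ ⟨s, hs, rfl⟩
    exact ⟨(z, s), ⟨hz, hs⟩, rfl⟩
  choose y hy using fun F : {F // IsKFace k P F} => F.2.1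
  set L : {F // IsKFace k P F} → EuclideanSpace ℝ (Fin n) × ℝ →L[ℝ] EuclideanSpace ℝ (Fin n) :=
    fun F => ((vectorSpan ℝ F.1)ᗮ.starProjection).comp (ContinuousLinearMap.fst ℝ _ _) +
      (ContinuousLinearMap.snd ℝ _ _).smulRight ((vectorSpan ℝ F.1)ᗮ.starProjection (y F)) with hL
  have hsub : A ⊆ ⋃ F : {F // IsKFace k P F},
      (L F '' K + (vectorSpan ℝ F.1 : Set (EuclideanSpace ℝ (Fin n)))) := by
    rintro _ ⟨⟨z, s⟩, ⟨hz, F, hF, hs⟩, rfl⟩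
    refine mem_iUnion.2 ⟨⟨F, hF⟩, L ⟨F, hF⟩ z, mem_image_of_mem _ hz,
      (vectorSpan ℝ F).starProjection (f (z, s)), Submodule.starProjection_apply_mem _ _, ?_⟩
    have h1 : L ⟨F, hF⟩ z = (vectorSpan ℝ F)ᗮ.starProjection (f (z, s)) := by
      simp only [hL, hf, map_add, map_smul, add_apply,
        ContinuousLinearMap.comp_apply, ContinuousLinearMap.coe_fst',
        ContinuousLinearMap.smulRight_apply, ContinuousLinearMap.coe_snd']
      rw [starProjection_orthogonal_eq_of_mem hs (hy ⟨F, hF⟩)]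
    simp only [h1]
    rw [add_comm, Submodule.starProjection_add_starProjection_orthogonal]
  refine (dimH_mono hsub).trans ?_
  rw [dimH_iUnion]
  refine iSup_le fun F => (dimH_add_submodule_le _ _).trans ?_
  rw [F.2.2.2]
  gcongr
  refine hKL F (L F) fun w hw => ?_
  simpa [hL] using hφ F w hw (y F) (hy F)

/-- The graph data for a face whose affine span avoids the origin. -/
lemma IsKFace.exists_graph_of_zero_notMem (hF : IsKFace k P F)
    (h0 : (0 : EuclideanSpace ℝ (Fin n)) ∉ affineSpan ℝ F) :
    ∃ (W : Submodule ℝ (EuclideanSpace ℝ (Fin n))) (φ : EuclideanSpace ℝ (Fin n) →L[ℝ] ℝ),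
      Module.finrank ℝ W = k + 1 ∧ vectorSpan ℝ F ≤ W ∧ F ⊆ W ∧ ∀ w ∈ W, ∀ s ∈ F,
        (vectorSpan ℝ F)ᗮ.starProjection w + φ w • (vectorSpan ℝ F)ᗮ.starProjection s = 0 := by
  obtain ⟨y, hy⟩ := hF.1
  set V := vectorSpan ℝ F with hV
  set h := Vᗮ.starProjection y with hh
  have hh0 : h ≠ 0 := fun hz => h0 ((starProjection_orthogonal_eq_zero_iff hy).1 hz)
  have hhV : h ∈ Vᗮ := Submodule.starProjection_apply_mem _ _
  have hproj : ∀ s ∈ F, Vᗮ.starProjection s = h := fun s hs =>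
    starProjection_orthogonal_eq_of_mem hs hy
  -- Moving the center by a h shifts the carrying translate by a h; lowering the radius by a shifts
  -- it back. The functional φ is minus the coordinate along h.
  refine ⟨V ⊔ Submodule.span ℝ {h}, -((‖h‖ ^ 2)⁻¹ • innerSL ℝ h), ?_, le_sup_left, ?_, ?_⟩
  · have hinf : V ⊓ Submodule.span ℝ {h} = ⊥ := by
      refine (V.orthogonal_disjoint.mono_right ?_).eq_bot
      rwa [Submodule.span_singleton_le_iff_mem]
    have h1 := Submodule.finrank_sup_add_finrank_inf_eq V (Submodule.span ℝ {h})
    rw [hinf, finrank_bot, add_zero, finrank_span_singleton hh0, hF.2.2] at h1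
    exact h1
  · intro s hs
    rw [← V.starProjection_add_starProjection_orthogonal s, hproj s hs]
    exact Submodule.add_mem_sup (Submodule.starProjection_apply_mem _ _)
      (Submodule.mem_span_singleton_self h)
  · intro w hw s hs
    rw [hproj s hs]
    obtain ⟨v, hv, z, hz, rfl⟩ := Submodule.mem_sup.1 hw
    obtain ⟨a, rfl⟩ := Submodule.mem_span_singleton.1 hz
    have h1 : Vᗮ.starProjection (v + a • h) = a • h := by
      rw [map_add, V.starProjection_orthogonal_apply_eq_zero hv, zero_add,
        Submodule.starProjection_eq_self_iff.2 (Submodule.smul_mem _ _ hhV)]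
    have h2 : inner ℝ h v = 0 := by
      rw [real_inner_comm]; exact hhV v hv
    have h3 : ‖h‖ ^ 2 ≠ 0 := by simpa using hh0
    have h4 : (-((‖h‖ ^ 2)⁻¹ • innerSL ℝ h)) (v + a • h) = -a := by
      simp only [neg_apply, smul_apply, innerSL_apply_apply,
        inner_add_right, h2, inner_smul_right, real_inner_self_eq_norm_sq, smul_eq_mul, zero_add]
      field_simp
    rw [h1, h4, neg_smul, add_neg_cancel]

lemma ofReal_sub_natCast_add (x : ℝ) (k : ℕ) :
    ENNReal.ofReal (x - k) + k = ENNReal.ofReal (max x k) := by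
  rw [← ENNReal.ofReal_natCast, ENNReal.ofReal_max]
  rcases le_total x k with h | h
  · rw [ENNReal.ofReal_of_nonpos (sub_nonpos.2 h), zero_add,
      max_eq_right (ENNReal.ofReal_le_ofReal h)]
  · rw [← ENNReal.ofReal_add (sub_nonneg.2 h) (Nat.cast_nonneg k), sub_add_cancel,
      max_eq_left (ENNReal.ofReal_le_ofReal h)]

end Faces

/-! ### The two cases of the theorem -/

theorem theorem2p1 (n k : ℕ) (hk : k < n) (d : ℝ) (hd : d ∈ Set.Icc (0 : ℝ) (n : ℝ))
    (P : Set (EuclideanSpace ℝ (Fin n))) (hP : IsPolytope P) (hS : (kSkeleton k P).Nonempty) :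
    ((∀ F, IsKFace k P F → (0 : EuclideanSpace ℝ (Fin n)) ∉ affineSpan ℝ F) →
      IsLeast (possibleDims (kSkeleton k P) d) (ENNReal.ofReal (max (d - 1) (k : ℝ)))) ∧
    ((∃ F, IsKFace k P F ∧ (0 : EuclideanSpace ℝ (Fin n)) ∈ affineSpan ℝ F) →
      IsLeast (possibleDims (kSkeleton k P) d) (ENNReal.ofReal (max d (k : ℝ)))) := by
  have hn : 0 < n := by omega
  have hleast : ∀ {S : Set ℝ≥0∞} {b a : ℝ≥0∞}, (∀ x ∈ S, b ≤ x) → a ∈ S → a ≤ b → IsLeast S b := by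
    intro S b a hlb ha hab
    obtain rfl : a = b := le_antisymm hab (hlb a ha)
    exact ⟨ha, hlb⟩
  have hkn : (k : ℝ≥0∞) = ENNReal.ofReal k := (ENNReal.ofReal_natCast k).symm
  constructor
  · intro h0
    have hlb : ∀ a ∈ possibleDims (kSkeleton k P) d, ENNReal.ofReal (max (d - 1) (k : ℝ)) ≤ a := by
      rintro _ ⟨A, C, -, -, hC, hCd, hcopies, rfl⟩
      obtain ⟨_, F, hF, -⟩ := hS
      obtain ⟨W, φ, hW, hVW, hFW, -⟩ := hF.exists_graph_of_zero_notMem (h0 F hF)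
      obtain ⟨h1, h2⟩ := hF.dimH_le hP hC hcopies W hVW hFW
      rw [ENNReal.ofReal_max, ← hkn]
      refine max_le ?_ h1
      rw [hW, hCd, Nat.cast_add, Nat.cast_one, add_comm (k : ℝ≥0∞) 1, ← add_assoc,
        ENNReal.add_le_add_iff_right (ENNReal.natCast_ne_top k)] at h2
      rw [ENNReal.ofReal_sub _ zero_le_one, ENNReal.ofReal_one]
      exact tsub_le_iff_right.2 h2
    obtain ⟨a, ha, hab⟩ := hP.exists_mem_possibleDims_le hn hS hd (p := k + 1) hk fun F hF => by
      obtain ⟨W, φ, hW, -, -, hφ⟩ := hF.exists_graph_of_zero_notMem (h0 F hF)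
      exact ⟨W, φ, hW, hφ⟩
    refine hleast hlb ha (hab.trans (le_of_eq ?_))
    rw [← ofReal_sub_natCast_add]
    congr 2
    push_cast; ring
  · rintro ⟨F, hF, hF0⟩
    have hlb : ∀ a ∈ possibleDims (kSkeleton k P) d, ENNReal.ofReal (max d (k : ℝ)) ≤ a := by
      rintro _ ⟨A, C, -, -, hC, hCd, hcopies, rfl⟩
      have hFV : F ⊆ vectorSpan ℝ F := fun y hy => by
        have := vsub_mem_vectorSpan_of_mem_affineSpan_of_mem_affineSpan (mem_affineSpan ℝ hy) hF0
        simpa using this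
      obtain ⟨h1, h2⟩ := hF.dimH_le hP hC hcopies _ le_rfl hFV
      rw [ENNReal.ofReal_max, ← hkn]
      refine max_le ?_ h1
      rwa [hF.2.2, hCd, ENNReal.add_le_add_iff_right (ENNReal.natCast_ne_top k)] at h2
    -- With φ = 0 all radii are equal. This collapses the direction of every k-face, whether or not
    -- its affine span contains 0.
    obtain ⟨a, ha, hab⟩ := hP.exists_mem_possibleDims_le hn hS hd (p := k) hk.le fun F hF =>
      ⟨vectorSpan ℝ F, 0, hF.2.2, fun w hw s _ => by
        simpa using Submodule.starProjection_orthogonal_apply_eq_zero hw⟩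
    refine hleast hlb ha (hab.trans (le_of_eq ?_))
    exact ofReal_sub_natCast_add d k
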